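/- Let $P\subset\mathbb H^n$ be a Coxeter polytope: an intersection of finitely many half-spaces, with non-empty interior and finite volume, all of whose dihedral angles are integral submultiples of $\pi$. Let $\Gamma_P<\mathrm{Isom}(\mathbb H^n)$ be the group generated by the reflections through the hyperplanes supporting the facets of $P$, let $\mathrm{Sym}(P)<\mathrm{Isom}(\mathbb H^n)$ be the group of isometries mapping $P$ onto itself, and let $\widehat\Gamma_P=\langle\Gamma_P,\mathrm{Sym}(P)\rangle$. We regard $P$ as the orbifold $\mathbb H^n/\Gamma_P$ and $P/\mathrm{Sym}(P)$ as the orbifold $\mathbb H^n/\widehat\Gamma_P$. Let $M=\mathbb H^n/\Gamma$ be a complete hyperbolic manifold ($\Gamma<\mathrm{Isom}(\mathbb H^n)$ discrete and acting freely) that is obtained from finitely many copies of $P$ by pairing all their facets through isometries; that is, there is a homeomorphism from the glued space onto $M$ which on each copy of $P$ is locally induced by isometries of $\mathbb H^n$. Suppose that each pairing map is the restriction of a symmetry of $P$. Then: 1. $\Gamma_P$ is discrete and the orbifolds $M$ and $P$ are commensurable, that is, for some $g\in\mathrm{Isom}(\mathbb H^n)$ the group $\Gamma\cap g\Gamma_Pg^{-1}$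 has finite index in both $\Gamma$ and $g\Gamma_Pg^{-1}$; 2. $\widehat\Gamma_P$ is discrete and $M$ covers the orbifold $P/\mathrm{Sym}(P)$, that is, there is an isometry $g$ of $\mathbb H^n$ with $g\Gamma g^{-1}\le\widehat\Gamma_P$, so that $[x]\mapsto[gx]$ defines an orbifold covering $M\to P/\mathrm{Sym}(P)$. -/

import Mathlib

open scoped Pointwise Topology Matrix ENNReal

noncomputable section

namespace Hyperbolic

/-- The Lorentzian product of Minkowski space, `-x₀y₀ + x₁y₁ + ⋯ + xₙyₙ`. -/
def lorentz {n : ℕ} (x y : Fin (n + 1) → ℝ) : ℝ :=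
  -(x 0 * y 0) + ∑ i : Fin n, x i.succ * y i.succ

section LorentzFacts

variable {n : ℕ}

theorem lorentz_comm (x y : Fin (n + 1) → ℝ) : lorentz x y = lorentz y x := by
  simp only [lorentz, mul_comm]

theorem lorentz_add_left (x y z : Fin (n + 1) → ℝ) :
    lorentz (x + y) z = lorentz x z + lorentz y z := by
  simp only [lorentz, Pi.add_apply, add_mul, Finset.sum_add_distrib]
  ring

theorem lorentz_smul_left (a : ℝ) (x z : Fin (n + 1) → ℝ) :
    lorentz (a • x) z = a * lorentz x z := by
  simp only [lorentz, Pi.smul_apply, smul_eq_mul, mul_add, Finset.mul_sum, mul_assoc]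
  ring

theorem lorentz_add_right (x y z : Fin (n + 1) → ℝ) :
    lorentz x (y + z) = lorentz x y + lorentz x z := by
  rw [lorentz_comm, lorentz_add_left, lorentz_comm y, lorentz_comm z]

theorem lorentz_smul_right (a : ℝ) (x z : Fin (n + 1) → ℝ) :
    lorentz x (a • z) = a * lorentz x z := by
  rw [lorentz_comm, lorentz_smul_left, lorentz_comm]

theorem lorentz_neg_neg (x y : Fin (n + 1) → ℝ) : lorentz (-x) (-y) = lorentz x y := by
  simp [lorentz]

end LorentzFacts

/-- Hyperbolic `n`-space `ℍⁿ` (hyperboloid model), with the topology induced by `ℝⁿ⁺¹`. -/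
def HSpace (n : ℕ) : Type :=
  {x : Fin (n + 1) → ℝ // lorentz x x = -1 ∧ 0 < x 0}

instance (n : ℕ) : TopologicalSpace (HSpace n) :=
  inferInstanceAs (TopologicalSpace {x : Fin (n + 1) → ℝ // lorentz x x = -1 ∧ 0 < x 0})

/-- The isometry group `Isom(ℍⁿ)`: the invertible real matrices that preserve the Lorentzian
product and map the upper sheet of the hyperboloid to itself. Its topology is the one induced by
the topology of the matrix group. -/
def Isom (n : ℕ) : Subgroup (GL (Fin (n + 1)) ℝ) where
  carrier := {A | (∀ x y, lorentz (A.1 *ᵥ x) (A.1 *ᵥ y) = lorentz x y) ∧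
    ∀ x, lorentz x x = -1 ∧ 0 < x 0 → 0 < (A.1 *ᵥ x) 0}
  one_mem' := by simp
  mul_mem' := by
    intro A B hA hB
    refine ⟨fun x y => ?_, fun x hx => ?_⟩
    · simp only [Units.val_mul, ← Matrix.mulVec_mulVec]
      rw [hA.1, hB.1]
    · simp only [Units.val_mul, ← Matrix.mulVec_mulVec]
      exact hA.2 _ ⟨by rw [hB.1, hx.1], hB.2 x hx⟩
  inv_mem' := by
    intro A hA
    have hAi : ∀ x, A.1 *ᵥ ((A⁻¹).1 *ᵥ x) = x := fun x => by
      rw [Matrix.mulVec_mulVec, ← Units.val_mul]; simp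
    have h1 : ∀ x y, lorentz ((A⁻¹).1 *ᵥ x) ((A⁻¹).1 *ᵥ y) = lorentz x y := fun x y => by
      rw [← hA.1, hAi, hAi]
    refine ⟨h1, fun x hx => ?_⟩
    by_contra hneg
    have hq : lorentz ((A⁻¹).1 *ᵥ x) ((A⁻¹).1 *ᵥ x) = -1 := by rw [h1, hx.1]
    have hne : ((A⁻¹).1 *ᵥ x) 0 ≠ 0 := by
      intro h0
      have hnn : 0 ≤ ∑ i : Fin n, ((A⁻¹).1 *ᵥ x) i.succ * ((A⁻¹).1 *ᵥ x) i.succ :=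
        Finset.sum_nonneg fun i _ => mul_self_nonneg _
      rw [lorentz, h0] at hq
      linarith
    have hlt : ((A⁻¹).1 *ᵥ x) 0 < 0 := lt_of_le_of_ne (not_lt.mp hneg) hne
    have := hA.2 (-((A⁻¹).1 *ᵥ x)) ⟨by rw [lorentz_neg_neg, hq], by simpa using hlt⟩
    rw [Matrix.mulVec_neg, hAi] at this
    have h2 := hx.2
    simp only [Pi.neg_apply] at this
    linarith

/-- The action of `Isom(ℍⁿ)` on `ℍⁿ`. -/
instance (n : ℕ) : MulAction (Isom n) (HSpace n) where
  smul A x := ⟨A.1.1 *ᵥ x.1, by rw [A.2.1]; exact x.2.1, A.2.2 _ x.2⟩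
  one_smul x := Subtype.ext (by
    change ((1 : Isom n).1.1 *ᵥ x.1) = x.1
    simp)
  mul_smul A B x := Subtype.ext (by
    change ((A * B).1.1 *ᵥ x.1) = A.1.1 *ᵥ (B.1.1 *ᵥ x.1)
    simp [Matrix.mulVec_mulVec])

/-- The linear map `x ↦ x - 2⟨x,v⟩v`. -/
def reflectionLin {n : ℕ} (v : Fin (n + 1) → ℝ) :
    (Fin (n + 1) → ℝ) →ₗ[ℝ] (Fin (n + 1) → ℝ) where
  toFun x := x + (-2 * lorentz x v) • v
  map_add' x y := by
    rw [lorentz_add_left]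
    module
  map_smul' a x := by
    rw [lorentz_smul_left, RingHom.id_apply]
    module

theorem reflectionLin_apply {n : ℕ} (v x : Fin (n + 1) → ℝ) :
    reflectionLin v x = x + (-2 * lorentz x v) • v := rfl

theorem reflectionLin_comp {n : ℕ} {v : Fin (n + 1) → ℝ} (hv : lorentz v v = 1) :
    reflectionLin v ∘ₗ reflectionLin v = LinearMap.id := by
  ext1 x
  ext1
  simp only [LinearMap.comp_apply, reflectionLin_apply, LinearMap.id_apply, lorentz_add_left,
    lorentz_smul_left, hv]
  module

theorem lorentz_reflectionLin {n : ℕ} {v : Fin (n + 1) → ℝ} (hv : lorentz v v = 1)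
    (x y : Fin (n + 1) → ℝ) :
    lorentz (reflectionLin v x) (reflectionLin v y) = lorentz x y := by
  simp only [reflectionLin_apply, lorentz_add_left, lorentz_smul_left, lorentz_add_right,
    lorentz_smul_right, hv, lorentz_comm v y]
  ring

/-- A reflection in a space-like unit vector preserves the upper sheet. -/
theorem reflectionLin_pos {n : ℕ} {v : Fin (n + 1) → ℝ} (hv : lorentz v v = 1)
    (x : Fin (n + 1) → ℝ) (hx : lorentz x x = -1 ∧ 0 < x 0) : 0 < reflectionLin v x 0 := by
  set y := reflectionLin v x with hy
  have hyy : lorentz y y = -1 := by rw [hy, lorentz_reflectionLin hv, hx.1]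
  have hxy : lorentz x y ≤ -1 := by
    rw [hy, reflectionLin_apply, lorentz_add_right, lorentz_smul_right, hx.1]
    nlinarith [sq_nonneg (lorentz x v)]
  by_contra hneg
  have hy0 : y 0 ≤ 0 := not_lt.mp hneg
  have hcs := Finset.sum_mul_sq_le_sq_mul_sq Finset.univ (fun i : Fin n => x i.succ)
    (fun i : Fin n => y i.succ)
  have hx1 : ∑ i : Fin n, x i.succ ^ 2 = x 0 ^ 2 - 1 := by
    have := hx.1
    simp only [lorentz, ← pow_two] at this
    linarith
  have hy1 : ∑ i : Fin n, y i.succ ^ 2 = y 0 ^ 2 - 1 := by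
    simp only [lorentz, ← pow_two] at hyy
    linarith
  rw [hx1, hy1] at hcs
  rw [lorentz] at hxy
  set s := ∑ i : Fin n, x i.succ * y i.succ
  have hxp := hx.2
  have h1 : 0 ≤ -(x 0 * y 0) := by nlinarith
  have h2 : 1 - x 0 * y 0 ≤ -s := by linarith
  have h3 : (1 - x 0 * y 0) ^ 2 ≤ s ^ 2 := by nlinarith
  nlinarith [sq_nonneg (x 0 + y 0), sq_nonneg (x 0 - y 0), sq_pos_of_pos hxp]

/-- The reflection of `ℍⁿ` through the hyperplane orthogonal to the space-like unit vector `v`. -/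
def reflection {n : ℕ} (v : Fin (n + 1) → ℝ) (hv : lorentz v v = 1) : Isom n :=
  ⟨⟨LinearMap.toMatrix' (reflectionLin v), LinearMap.toMatrix' (reflectionLin v),
      by rw [← LinearMap.toMatrix'_comp, reflectionLin_comp hv, LinearMap.toMatrix'_id],
      by rw [← LinearMap.toMatrix'_comp, reflectionLin_comp hv, LinearMap.toMatrix'_id]⟩,
    by
      refine ⟨fun x y => ?_, fun x hx => ?_⟩
      · simp only [LinearMap.toMatrix'_mulVec]
        exact lorentz_reflectionLin hv x y
      · simp only [LinearMap.toMatrix'_mulVec]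
        exact reflectionLin_pos hv x hx⟩

theorem reflection_smul_coe {n : ℕ} (v : Fin (n + 1) → ℝ) (hv : lorentz v v = 1)
    (x : HSpace n) : (reflection v hv • x).1 = x.1 + (-2 * lorentz x.1 v) • v :=
  LinearMap.toMatrix'_mulVec (reflectionLin v) x.1

/-- The point of the hyperboloid vertically above `y ∈ ℝⁿ`. -/
def lift {n : ℕ} (y : Fin n → ℝ) : HSpace n :=
  ⟨Fin.cons (Real.sqrt (1 + ∑ i, y i ^ 2)) y, by
    have h : 0 < 1 + ∑ i, y i ^ 2 := by positivity
    refine ⟨?_, ?_⟩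
    · simp only [lorentz, Fin.cons_zero, Fin.cons_succ, Real.mul_self_sqrt h.le, ← pow_two]
      ring
    · simpa using Real.sqrt_pos.mpr h⟩

/-- Hyperbolic volume. In the coordinates `y ∈ ℝⁿ` given by vertical projection of the hyperboloid
the volume form of `ℍⁿ` is `dy / √(1 + |y|²)`. -/
def hvolume {n : ℕ} (S : Set (HSpace n)) : ℝ≥0∞ :=
  ∫⁻ y in {y : Fin n → ℝ | lift y ∈ S},
    ENNReal.ofReal (1 / Real.sqrt (1 + ∑ i, y i ^ 2))

/-- A convex polytope in `ℍⁿ`: the intersection of finitely many half-spaces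
`{x | ⟨x, vₖ⟩ ≤ 0}`, none of which can be omitted, with non-empty interior and finite volume.
The `vₖ` are the outward unit normal vectors. -/
structure Polytope (n : ℕ) where
  numFacets : ℕ
  normal : Fin numFacets → Fin (n + 1) → ℝ
  normal_unit : ∀ k, lorentz (normal k) (normal k) = 1
  irredundant : ∀ k, ∃ x : HSpace n, 0 < lorentz x.1 (normal k) ∧
    ∀ l, l ≠ k → lorentz x.1 (normal l) ≤ 0
  interior_nonempty : ∃ x : HSpace n, ∀ k, lorentz x.1 (normal k) < 0
  finite_volume : hvolume {x : HSpace n | ∀ k, lorentz x.1 (normal k) ≤ 0} < ∞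

namespace Polytope

variable {n : ℕ} (P : Polytope n)

/-- The underlying set of the polytope. -/
def carrier : Set (HSpace n) := {x | ∀ k, lorentz x.1 (P.normal k) ≤ 0}

/-- The `k`-th facet of the polytope. -/
def facet (k : Fin P.numFacets) : Set (HSpace n) :=
  {x | x ∈ P.carrier ∧ lorentz x.1 (P.normal k) = 0}

/-- Two distinct facets are adjacent if they meet in a face of codimension two: some point of
`P` lies on these two facets and on no other one. -/
def Adjacent (k l : Fin P.numFacets) : Prop :=
  k ≠ l ∧ ∃ x ∈ P.carrier, ∀ j, lorentz x.1 (P.normal j) = 0 ↔ j = k ∨ j = l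

/-- The dihedral angle between two adjacent facets, computed from the outward unit normals. -/
def dihedralAngle (k l : Fin P.numFacets) : ℝ :=
  Real.arccos (-lorentz (P.normal k) (P.normal l))

/-- A Coxeter polytope: all dihedral angles are integral submultiples of `π`. -/
def IsCoxeter : Prop :=
  ∀ k l, P.Adjacent k l → ∃ m : ℕ, 2 ≤ m ∧ P.dihedralAngle k l = Real.pi / m

/-- The group generated by the reflections through the supporting hyperplanes of the facets;
a Coxeter polytope `P` is interpreted as the orbifold `ℍⁿ / P.reflectionGroup`. -/
def reflectionGroup : Subgroup (Isom n) :=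
  Subgroup.closure (Set.range fun k => reflection (P.normal k) (P.normal_unit k))

/-- The symmetry group `Sym(P)`: the isometries of `ℍⁿ` that map `P` onto itself. -/
def symmetryGroup : Subgroup (Isom n) := MulAction.stabilizer (Isom n) P.carrier

/-- The orbifold fundamental group of `P / Sym(P)`, the quotient of the orbifold
`ℍⁿ / P.reflectionGroup` by the action of `Sym(P)`. -/
def extendedGroup : Subgroup (Isom n) := P.reflectionGroup ⊔ P.symmetryGroup

end Polytope

/-- A pairing of all the facets of finitely many copies of `P`. The pair `(i, k)` stands for the
`k`-th facet of the `i`-th copy; it is paired with the facet `mate (i, k)` through the isometry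
of facets `x ↦ map (i, k) • x` (every isometry between facets of `P` extends to an isometry of
`ℍⁿ`; only its values on the facet matter). The pairing map of `mate (i, k)` is the inverse. -/
structure FacetPairing {n : ℕ} (P : Polytope n) where
  numCopies : ℕ
  mate : Fin numCopies × Fin P.numFacets → Fin numCopies × Fin P.numFacets
  map : Fin numCopies × Fin P.numFacets → Isom n
  mate_mate : ∀ c, mate (mate c) = c
  map_facet : ∀ c, map c • P.facet c.2 = P.facet (mate c).2
  map_mate : ∀ c, ∀ x ∈ P.facet c.2, map (mate c) • map c • x = x

namespace FacetPairing

variable {n : ℕ} {P : Polytope n} (G : FacetPairing P)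

/-- The elementary identifications: a point `x` of the `k`-th facet of the `i`-th copy is glued to
its image under the pairing map. -/
def Rel (a b : Fin G.numCopies × P.carrier) : Prop :=
  ∃ k, a.2.1 ∈ P.facet k ∧ (G.mate (a.1, k)).1 = b.1 ∧ b.2.1 = G.map (a.1, k) • a.2.1

/-- The space obtained from the copies of `P` by the facet pairing: the quotient of their disjoint
union by the equivalence relation generated by the identifications. -/
def Space : Type := Quot G.Rel

instance : TopologicalSpace G.Space := inferInstanceAs (TopologicalSpace (Quot G.Rel))

/-- The point of the glued space represented by the point `x` of the `i`-th copy of `P`. -/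
def point (i : Fin G.numCopies) (x : P.carrier) : G.Space := Quot.mk G.Rel (i, x)

/-- Each pairing map is the restriction of a symmetry of `P`. -/
def InducedBySymmetries : Prop :=
  ∀ c, ∃ s ∈ P.symmetryGroup, ∀ x ∈ P.facet c.2, G.map c • x = s • x

end FacetPairing

/-- The quotient space `ℍⁿ / Γ`. -/
abbrev QuotientSpace {n : ℕ} (Γ : Subgroup (Isom n)) : Type :=
  Quotient (MulAction.orbitRel Γ (HSpace n))

/-- The class of a point in `ℍⁿ / Γ`. -/
def QuotientSpace.mk {n : ℕ} (Γ : Subgroup (Isom n)) (x : HSpace n) : QuotientSpace Γ :=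
  Quotient.mk (MulAction.orbitRel Γ (HSpace n)) x

/-- `ℍⁿ / Γ` is a complete hyperbolic manifold: `Γ` is discrete and acts freely on `ℍⁿ`. -/
structure IsManifoldGroup {n : ℕ} (Γ : Subgroup (Isom n)) : Prop where
  discrete : DiscreteTopology Γ
  free : ∀ γ ∈ Γ, ∀ x : HSpace n, γ • x = x → γ = 1

/-- The homeomorphism `Φ` from the glued space to `ℍⁿ / Γ` respects the hyperbolic structures:
on each copy of `P` it is, locally, induced by isometries of `ℍⁿ`. -/
def FacetPairing.IsIsometric {n : ℕ} {P : Polytope n} (G : FacetPairing P)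
    {Γ : Subgroup (Isom n)} (Φ : G.Space ≃ₜ QuotientSpace Γ) : Prop :=
  ∀ (i : Fin G.numCopies) (p : P.carrier), ∃ g : Isom n,
    ∀ᶠ x in 𝓝 p, Φ (G.point i x) = QuotientSpace.mk Γ (g • x.1)

/-- The conjugate `g Γ g⁻¹`. -/
def conj {n : ℕ} (g : Isom n) (Γ : Subgroup (Isom n)) : Subgroup (Isom n) :=
  Γ.map (MulAut.conj g).toMonoidHom

/-- The hyperbolic orbifolds `ℍⁿ / Γ` and `ℍⁿ / Γ'` are commensurable: for some isometry `g` the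
group `Γ ∩ gΓ'g⁻¹` has finite index in both `Γ` and `gΓ'g⁻¹`. -/
def OrbifoldCommensurable {n : ℕ} (Γ Γ' : Subgroup (Isom n)) : Prop :=
  ∃ g : Isom n, Subgroup.Commensurable Γ (conj g Γ')

/-- The map `f : ℍⁿ / Γ → ℍⁿ / Λ` is an orbifold covering (a local isometry of hyperbolic
orbifolds): it is induced by an isometry `g` of `ℍⁿ` that conjugates `Γ` into `Λ`. -/
def IsOrbifoldCovering {n : ℕ} {Γ Λ : Subgroup (Isom n)}
    (f : QuotientSpace Γ → QuotientSpace Λ) : Prop :=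
  ∃ g : Isom n, conj g Γ ≤ Λ ∧
    ∀ x : HSpace n, f (QuotientSpace.mk Γ x) = QuotientSpace.mk Λ (g • x)

end Hyperbolic

end

/-! By `exists_chart`, the `i`-th copy of P is carried into M by a single isometry `g i`, so the
polytopes γ gᵢ P with γ ∈ Γ are the lifts of the copies to ℍⁿ. A tile is recorded by an isometry
carrying P onto it, ambiguous up to Sym(P) (`IsTile`). If an inner point of one tile lies in
another, the tiles coincide (`tile_eq`), because Φ is injective and Γ acts freely.

The crux is what lies across a facet (`tile_mul_reflection`). The pairing map is the restriction of
a symmetry s, so the chart of the partner copy composed with s agrees with gᵢ on the facet, up to an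
element of Γ. The comparison isometry fixes the facet pointwise, so it is the identity or the
reflection. The identity would force the facet to be glued to itself trivially, giving M a boundary
(`not_mirror`). So the neighbouring tile is the mirror image, and the set of tiles is stable under
right multiplication by the extended group (`tile_mul`).

The rest is bookkeeping. If w in the extended group sends an inner point to an inner point, then gᵢ
and gᵢw give overlapping tiles, so w ∈ Sym(P). This group is finite since, for n ≥ 1, finite volume
forces the normals to span (`finite_symmetryGroup`); hence the extended group is discrete. The
translates of P under the now discrete reflection group cover ℍⁿ, so every tile has the form gᵢws
with w in the reflection group and s ∈ Sym(P). Applied to the tile γgᵢ this conjugates Γ into the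
extended group. Conversely gᵢw = γgⱼs leaves finitely many pairs (j, s), which bounds the index. -/

namespace Hyperbolic

open Filter Set

/-! ### Minkowski geometry and radial projection to the hyperboloid -/

section Lorentz

variable {n : ℕ}

theorem lorentz_neg_left (x y : Fin (n + 1) → ℝ) : lorentz (-x) y = -lorentz x y := by
  simpa using lorentz_smul_left (-1) x y

theorem lorentz_neg_right (x y : Fin (n + 1) → ℝ) : lorentz x (-y) = -lorentz x y := by
  rw [lorentz_comm, lorentz_neg_left, lorentz_comm]

theorem lorentz_sub_left (x y z : Fin (n + 1) → ℝ) :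
    lorentz (x - y) z = lorentz x z - lorentz y z := by
  rw [sub_eq_add_neg, lorentz_add_left, lorentz_neg_left, sub_eq_add_neg]

@[fun_prop]
theorem continuous_lorentz {X : Type*} [TopologicalSpace X] {f g : X → Fin (n + 1) → ℝ}
    (hf : Continuous f) (hg : Continuous g) : Continuous fun x => lorentz (f x) (g x) := by
  unfold lorentz
  fun_prop

theorem lorentz_single_zero (x : Fin (n + 1) → ℝ) : lorentz x (Pi.single 0 1) = -x 0 := by
  simp [lorentz]

theorem lorentz_single_succ (x : Fin (n + 1) → ℝ) (i : Fin n) :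
    lorentz x (Pi.single i.succ 1) = x i.succ := by
  simp [lorentz, Pi.single_apply, (Fin.succ_ne_zero i).symm]

theorem eq_zero_of_lorentz_eq_zero {x : Fin (n + 1) → ℝ} (h : ∀ y, lorentz x y = 0) : x = 0 := by
  ext i
  induction i using Fin.cases with
  | zero => simpa [lorentz_single_zero] using h (Pi.single 0 1)
  | succ i => simpa [lorentz_single_succ] using h (Pi.single i.succ 1)

/-- The open future cone of Minkowski space. -/
def Future (z : Fin (n + 1) → ℝ) : Prop := lorentz z z < 0 ∧ 0 < z 0

theorem future_iff {z : Fin (n + 1) → ℝ} :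
    Future z ↔ Real.sqrt (∑ i : Fin n, z i.succ ^ 2) < z 0 := by
  have hl : lorentz z z = ∑ i : Fin n, z i.succ ^ 2 - z 0 ^ 2 := by
    simp only [lorentz, ← pow_two]; ring
  have hs : 0 ≤ ∑ i : Fin n, z i.succ ^ 2 := Finset.sum_nonneg fun i _ => sq_nonneg _
  unfold Future
  rw [hl]
  constructor
  · rintro ⟨h1, h2⟩
    rw [Real.sqrt_lt' h2]; linarith
  · intro h
    have h2 : 0 < z 0 := (Real.sqrt_nonneg _).trans_lt h
    rw [Real.sqrt_lt' h2] at h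
    exact ⟨by linarith, h2⟩

theorem HSpace.future (x : HSpace n) : Future x.1 := ⟨by rw [x.2.1]; norm_num, x.2.2⟩

theorem isOpen_future : IsOpen {z : Fin (n + 1) → ℝ | Future z} := by
  have h1 : IsOpen {z : Fin (n + 1) → ℝ | lorentz z z < 0} :=
    isOpen_lt (by fun_prop) continuous_const
  have h2 : IsOpen {z : Fin (n + 1) → ℝ | 0 < z 0} := isOpen_lt continuous_const (by fun_prop)
  exact h1.inter h2

/-- A quantitative form of the reversed Cauchy-Schwarz inequality. -/
theorem Future.lorentz_le (x : Fin (n + 1) → ℝ) {y : Fin (n + 1) → ℝ} (hy : Future y) :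
    (x 0 - Real.sqrt (∑ i : Fin n, x i.succ ^ 2)) * y 0 ≤ -lorentz x y := by
  have h := Real.sum_mul_le_sqrt_mul_sqrt Finset.univ (fun i : Fin n => x i.succ)
    (fun i : Fin n => y i.succ)
  have hy' := future_iff.1 hy
  have := mul_le_mul_of_nonneg_left hy'.le (Real.sqrt_nonneg (∑ i : Fin n, x i.succ ^ 2))
  unfold lorentz
  linarith

theorem Future.lorentz_neg {x y : Fin (n + 1) → ℝ} (hx : Future x) (hy : Future y) :
    lorentz x y < 0 := by
  have := hy.lorentz_le x
  have h2 := future_iff.1 hx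
  have := mul_pos (sub_pos.2 h2) hy.2
  linarith

theorem Future.add {x y : Fin (n + 1) → ℝ} (hx : Future x) (hy : Future y) : Future (x + y) := by
  refine ⟨?_, add_pos hx.2 hy.2⟩
  rw [lorentz_add_left, lorentz_add_right, lorentz_add_right]
  linarith [hx.1, hy.1, hx.lorentz_neg hy, hy.lorentz_neg hx]

theorem Future.smul {x : Fin (n + 1) → ℝ} (hx : Future x) {a : ℝ} (ha : 0 < a) :
    Future (a • x) := by
  refine ⟨?_, mul_pos ha hx.2⟩
  rw [lorentz_smul_left, lorentz_smul_right]
  nlinarith [hx.1, mul_pos ha ha]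

open Classical in
/-- The radial projection of the future cone to the hyperboloid. -/
noncomputable def normalize (z : Fin (n + 1) → ℝ) : HSpace n :=
  if h : Future z then
    ⟨(Real.sqrt (-lorentz z z))⁻¹ • z, by
      have h1 : 0 < -lorentz z z := by linarith [h.1]
      refine ⟨?_, mul_pos (inv_pos.2 (Real.sqrt_pos.2 h1)) h.2⟩
      rw [lorentz_smul_left, lorentz_smul_right, ← mul_assoc, ← mul_inv, Real.mul_self_sqrt h1.le,
        inv_neg, neg_mul, inv_mul_cancel₀ h.1.ne]⟩
  else lift 0

theorem normalize_coe {z : Fin (n + 1) → ℝ} (h : Future z) :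
    (normalize z).1 = (Real.sqrt (-lorentz z z))⁻¹ • z := by
  simp [normalize, h]

theorem Future.scale_pos {z : Fin (n + 1) → ℝ} (h : Future z) :
    0 < (Real.sqrt (-lorentz z z))⁻¹ :=
  inv_pos.2 (Real.sqrt_pos.2 (by linarith [h.1]))

theorem normalize_self (x : HSpace n) : normalize x.1 = x := by
  apply Subtype.ext
  rw [normalize_coe x.future, x.2.1]
  simp

theorem lorentz_normalize_neg {z : Fin (n + 1) → ℝ} (h : Future z) (v : Fin (n + 1) → ℝ) :
    lorentz (normalize z).1 v < 0 ↔ lorentz z v < 0 := by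
  rw [normalize_coe h, lorentz_smul_left]
  have := h.scale_pos
  exact ⟨fun h' => by by_contra hc; exact absurd h' (not_lt.2 (mul_nonneg this.le (not_lt.1 hc))),
    mul_neg_of_pos_of_neg this⟩

theorem lorentz_normalize_nonpos {z : Fin (n + 1) → ℝ} (h : Future z) (v : Fin (n + 1) → ℝ) :
    lorentz (normalize z).1 v ≤ 0 ↔ lorentz z v ≤ 0 := by
  rw [normalize_coe h, lorentz_smul_left, ← not_lt, mul_pos_iff_of_pos_left h.scale_pos, not_lt]

theorem lorentz_normalize_eq_zero {z : Fin (n + 1) → ℝ} (h : Future z) (v : Fin (n + 1) → ℝ) :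
    lorentz (normalize z).1 v = 0 ↔ lorentz z v = 0 := by
  rw [normalize_coe h, lorentz_smul_left, mul_eq_zero_iff_left h.scale_pos.ne']

theorem smul_coe (A : Isom n) (x : HSpace n) : (A • x).1 = A.1.1 *ᵥ x.1 := rfl

theorem smul_normalize_eq_iff (A B : Isom n) {z : Fin (n + 1) → ℝ} (h : Future z) :
    A • normalize z = B • normalize z ↔ A.1.1 *ᵥ z = B.1.1 *ᵥ z := by
  have hc : A • normalize z = B • normalize z ↔ (A • normalize z).1 = (B • normalize z).1 :=
    Subtype.ext_iff
  rw [hc, smul_coe, smul_coe, normalize_coe h, Matrix.mulVec_smul,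
    Matrix.mulVec_smul]
  exact (smul_right_injective _ h.scale_pos.ne').eq_iff

theorem continuousAt_normalize {z : Fin (n + 1) → ℝ} (h : Future z) :
    ContinuousAt normalize z := by
  refine (Topology.IsInducing.continuousAt_iff (f := normalize)
    (g := fun x : HSpace n => x.1) ⟨rfl⟩).2 ?_
  have h1 : ContinuousAt (fun z : Fin (n + 1) → ℝ => (Real.sqrt (-lorentz z z))⁻¹ • z) z := by
    have h2 : ContinuousAt (fun z : Fin (n + 1) → ℝ => Real.sqrt (-lorentz z z)) z :=
      Continuous.continuousAt (by fun_prop)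
    exact (h2.inv₀ (inv_pos.1 h.scale_pos).ne').smul continuousAt_id
  refine h1.congr ?_
  filter_upwards [isOpen_future.mem_nhds h] with w hw
  exact (normalize_coe hw).symm

theorem tendsto_perturb (x w : Fin (n + 1) → ℝ) :
    Tendsto (fun ε : ℝ => x + ε • w) (𝓝[>] 0) (𝓝 x) := by
  have : Continuous fun ε : ℝ => x + ε • w := by fun_prop
  simpa using (this.tendsto 0).mono_left nhdsWithin_le_nhds

theorem eventually_future (p : HSpace n) (w : Fin (n + 1) → ℝ) :
    ∀ᶠ ε : ℝ in 𝓝[>] 0, Future (p.1 + ε • w) :=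
  (tendsto_perturb p.1 w).eventually (isOpen_future.mem_nhds p.future)

theorem eventually_lorentz_neg {x v : Fin (n + 1) → ℝ} (h : lorentz x v < 0)
    (w : Fin (n + 1) → ℝ) : ∀ᶠ ε : ℝ in 𝓝[>] 0, lorentz (x + ε • w) v < 0 :=
  (tendsto_perturb x w).eventually
    ((isOpen_lt (continuous_lorentz continuous_id continuous_const) continuous_const).mem_nhds h)

/-- The basic test curve: p + εw leaves the hyperboloid, but its projection tends to p and keeps the
signs of all products with normals. Local hypotheses at p thus yield linear information on arbitrary
w. -/
theorem tendsto_normalize (p : HSpace n) (w : Fin (n + 1) → ℝ) :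
    Tendsto (fun ε : ℝ => normalize (p.1 + ε • w)) (𝓝[>] 0) (𝓝 p) := by
  have h := (continuousAt_normalize p.future).tendsto.comp (tendsto_perturb p.1 w)
  rwa [normalize_self] at h

@[fun_prop]
theorem continuous_smul_const (x : HSpace n) : Continuous fun A : Isom n => A • x := by
  refine continuous_induced_rng.2 ?_
  change Continuous fun A : Isom n => A.1.1 *ᵥ x.1
  exact (Units.continuous_val.comp continuous_subtype_val).matrix_mulVec continuous_const

theorem continuous_const_smul_HSpace (A : Isom n) : Continuous fun x : HSpace n => A • x := by
  refine continuous_induced_rng.2 ?_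
  change Continuous fun x : HSpace n => A.1.1 *ᵥ x.1
  exact continuous_const.matrix_mulVec continuous_subtype_val

instance : ContinuousConstSMul (Isom n) (HSpace n) := ⟨continuous_const_smul_HSpace⟩

theorem isom_inv_mulVec (A : Isom n) (x : Fin (n + 1) → ℝ) :
    (A⁻¹).1.1 *ᵥ (A.1.1 *ᵥ x) = x := by
  change (A.1⁻¹).1 *ᵥ (A.1.1 *ᵥ x) = x
  rw [Matrix.mulVec_mulVec, ← Units.val_mul]
  simp

theorem lorentz_isom_inv (A : Isom n) (x y : Fin (n + 1) → ℝ) :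
    lorentz ((A⁻¹).1.1 *ᵥ x) y = lorentz x (A.1.1 *ᵥ y) := by
  have := (A⁻¹).2.1 x (A.1.1 *ᵥ y)
  rwa [isom_inv_mulVec] at this

theorem isom_ext {A B : Isom n} (h : ∀ w, A.1.1 *ᵥ w = B.1.1 *ᵥ w) : A = B := by
  apply Subtype.ext
  apply Units.ext
  exact Matrix.mulVec_injective (funext h)

/-- Two isometries that agree along all directions near a point are equal. -/
theorem isom_eq_of_eventually {A B : Isom n} {p : HSpace n}
    (h : ∀ᶠ x in 𝓝 p, A • x = B • x) : A = B := by
  refine isom_ext fun w => ?_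
  obtain ⟨ε, ⟨hε, hf⟩, h0⟩ := (((tendsto_normalize p w).eventually h).and
    (eventually_future p w)).and self_mem_nhdsWithin |>.exists
  have hp := congrArg Subtype.val h.self_of_nhds
  rw [smul_coe, smul_coe] at hp
  rw [smul_normalize_eq_iff A B hf, Matrix.mulVec_add, Matrix.mulVec_add, hp,
    Matrix.mulVec_smul, Matrix.mulVec_smul] at hε
  exact smul_right_injective _ (ne_of_gt h0) (add_left_cancel hε)

end Lorentz

/-! ### Discrete subgroups of the isometry group and proper discontinuity -/

section Discrete

variable {n : ℕ}

/-- The topology of units also records the inverse, but inversion is continuous by Cramer's rule.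
Compactness can therefore be checked on matrix entries. -/
theorem isEmbedding_matrix : Topology.IsEmbedding fun A : Isom n => A.1.1 := by
  have h : Topology.IsEmbedding (Units.val : GL (Fin (n + 1)) ℝ → _) := by
    refine Units.isEmbedding_val_mk' (f := fun M => M⁻¹) ?_ fun u => by simp
    intro M hM
    have hd : M.det ≠ 0 := by
      have := (Matrix.isUnit_iff_isUnit_det M).1 hM
      exact this.ne_zero
    refine ContinuousAt.continuousWithinAt ?_
    have : (fun M : Matrix (Fin (n + 1)) (Fin (n + 1)) ℝ => M⁻¹) =
        fun M => (M.det)⁻¹ • M.adjugate := by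
      funext M
      rw [Matrix.inv_def, Ring.inverse_eq_inv']
    rw [this]
    refine ContinuousAt.smul (ContinuousAt.inv₀ ?_ hd) ?_
    · exact (continuous_id.matrix_det).continuousAt
    · exact (continuous_id.matrix_adjugate).continuousAt
  exact h.comp Topology.IsEmbedding.subtypeVal

/-- The base point `(1, 0, …, 0)` of the hyperboloid. -/
def basePoint (n : ℕ) : HSpace n :=
  ⟨Pi.single 0 1, by rw [lorentz_single_zero]; simp, by simp⟩

theorem smul_basePoint (A : Isom n) (i : Fin (n + 1)) :
    (A • basePoint n).1 i = A.1.1 i 0 := by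
  change (A.1.1 *ᵥ Pi.single 0 1) i = _
  simp

/-- Nondegeneracy of the form gives invertibility. The sheet need only be checked at the base point,
because two future vectors have negative product. -/
theorem exists_isom_of_matrix (M : Matrix (Fin (n + 1)) (Fin (n + 1)) ℝ)
    (h : ∀ x y, lorentz (M *ᵥ x) (M *ᵥ y) = lorentz x y) (h0 : 0 < M 0 0) :
    ∃ A : Isom n, A.1.1 = M := by
  have hinj : Function.Injective M.mulVec := by
    intro x y hxy
    refine sub_eq_zero.1 (eq_zero_of_lorentz_eq_zero fun z => ?_)
    have hxy' : M *ᵥ x = M *ᵥ y := hxy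
    rw [← h, Matrix.mulVec_sub, hxy', sub_self]
    simpa using lorentz_smul_left 0 (M *ᵥ y) (M *ᵥ z)
  obtain ⟨u, hu⟩ := Matrix.mulVec_injective_iff_isUnit.1 hinj
  refine ⟨⟨u, ?_⟩, hu⟩
  change (∀ x y, lorentz (u.1 *ᵥ x) (u.1 *ᵥ y) = lorentz x y) ∧
    ∀ x, lorentz x x = -1 ∧ 0 < x 0 → 0 < (u.1 *ᵥ x) 0
  rw [hu]
  refine ⟨h, fun x hx => ?_⟩
  have hb : Future (M *ᵥ (basePoint n).1) := by
    refine ⟨by rw [h]; exact (basePoint n).future.1, ?_⟩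
    simpa [basePoint] using h0
  have hxf : Future x := ⟨by linarith [hx.1], hx.2⟩
  by_contra hneg
  have hq : lorentz (M *ᵥ x) (M *ᵥ x) < 0 := by rw [h]; exact hxf.1
  have hne : (M *ᵥ x) 0 ≠ 0 := by
    intro h0
    have hnn : 0 ≤ ∑ i : Fin n, (M *ᵥ x) i.succ * (M *ᵥ x) i.succ :=
      Finset.sum_nonneg fun i _ => mul_self_nonneg _
    rw [lorentz, h0] at hq
    linarith
  have hlt : (M *ᵥ x) 0 < 0 := lt_of_le_of_ne (not_lt.1 hneg) hne
  have hf : Future (-(M *ᵥ x)) := ⟨by rw [lorentz_neg_neg]; exact hq, by simpa using hlt⟩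
  have h1 := hb.lorentz_neg hf
  rw [lorentz_neg_right, h] at h1
  linarith [(basePoint n).future.lorentz_neg hxf]

theorem sum_sq_eq {x : Fin (n + 1) → ℝ} {a : ℝ} (h : lorentz x x = a) :
    ∑ i : Fin n, x i.succ ^ 2 = a + x 0 ^ 2 := by
  simp only [lorentz, ← pow_two] at h
  linarith

theorem sq_succ_le {x : Fin (n + 1) → ℝ} {a : ℝ} (h : lorentz x x = a) (i : Fin n) :
    x i.succ ^ 2 ≤ a + x 0 ^ 2 := by
  rw [← sum_sq_eq h]
  exact Finset.single_le_sum (f := fun i : Fin n => x i.succ ^ 2) (fun i _ => sq_nonneg _)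
    (Finset.mem_univ i)

theorem one_le_zero_coord (A : Isom n) : 1 ≤ A.1.1 0 0 := by
  have h := sum_sq_eq (A • basePoint n).2.1
  have h2 := (A • basePoint n).2.2
  have h3 : 0 ≤ ∑ i : Fin n, (A • basePoint n).1 i.succ ^ 2 :=
    Finset.sum_nonneg fun i _ => sq_nonneg _
  rw [smul_basePoint] at h h2
  nlinarith

theorem inv_zero_coord (A : Isom n) : (A⁻¹).1.1 0 0 = A.1.1 0 0 := by
  have h := lorentz_isom_inv A (Pi.single 0 1) (Pi.single 0 1)
  rw [lorentz_single_zero, lorentz_comm, lorentz_single_zero] at h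
  simpa using h

/-- The corner entry is cosh of the displacement of the base point. It bounds column 0, a vector of
norm -1; row 0 follows through the inverse, which has the same corner entry; the other columns have
norm 1. -/
theorem entry_sq_le (A : Isom n) {R : ℝ} (hR : A.1.1 0 0 ≤ R) (i j : Fin (n + 1)) :
    A.1.1 i j ^ 2 ≤ 1 + R ^ 2 := by
  have h1 := one_le_zero_coord A
  have hcol : ∀ B : Isom n, B.1.1 0 0 ≤ R → 1 ≤ B.1.1 0 0 → ∀ i, B.1.1 i 0 ^ 2 ≤ R ^ 2 := by
    intro B hB hB1 i
    have h00 : B.1.1 0 0 ^ 2 ≤ R ^ 2 := by nlinarith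
    induction i using Fin.cases with
    | zero => exact h00
    | succ i =>
      have h := sq_succ_le (B • basePoint n).2.1 i
      rw [smul_basePoint, smul_basePoint] at h
      linarith
  induction j using Fin.cases with
  | zero => linarith [hcol A hR h1 i]
  | succ j =>
    have hrow : A.1.1 0 j.succ ^ 2 ≤ R ^ 2 := by
      have h := lorentz_isom_inv A (Pi.single 0 1) (Pi.single j.succ 1)
      rw [lorentz_single_succ, lorentz_comm, lorentz_single_zero] at h
      simp only [Matrix.mulVec_single_one, Matrix.col_apply] at h
      have h2 := hcol A⁻¹ (by rwa [inv_zero_coord]) (one_le_zero_coord _) j.succ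
      rw [h] at h2
      simpa using h2
    induction i using Fin.cases with
    | zero => linarith
    | succ i =>
      have hu : lorentz (A.1.1 *ᵥ Pi.single j.succ 1) (A.1.1 *ᵥ Pi.single j.succ 1) = 1 := by
        rw [A.2.1, lorentz_single_succ]
        simp
      have h := sq_succ_le hu i
      simp only [Matrix.mulVec_single_one, Matrix.col_apply] at h
      linarith

theorem isCompact_bounded (R : ℝ) : IsCompact {A : Isom n | A.1.1 0 0 ≤ R} := by
  rw [isEmbedding_matrix.isInducing.isCompact_iff]
  have himg : (fun A : Isom n => A.1.1) '' {A : Isom n | A.1.1 0 0 ≤ R} =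
      {M | (∀ x y, lorentz (M *ᵥ x) (M *ᵥ y) = lorentz x y) ∧ 1 ≤ M 0 0 ∧ M 0 0 ≤ R} := by
    ext M
    constructor
    · rintro ⟨A, hA, rfl⟩
      exact ⟨A.2.1, one_le_zero_coord A, hA⟩
    · rintro ⟨h1, h2, h3⟩
      obtain ⟨A, rfl⟩ := exists_isom_of_matrix M h1 (by linarith)
      exact ⟨A, h3, rfl⟩
  have hclosed : IsClosed {M : Matrix (Fin (n + 1)) (Fin (n + 1)) ℝ |
      (∀ x y, lorentz (M *ᵥ x) (M *ᵥ y) = lorentz x y) ∧ 1 ≤ M 0 0 ∧ M 0 0 ≤ R} := by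
    have hc : Continuous fun M : Matrix (Fin (n + 1)) (Fin (n + 1)) ℝ => M 0 0 :=
      continuous_id.matrix_elem 0 0
    refine IsClosed.inter ?_ (IsClosed.inter ?_ ?_)
    · have : {M : Matrix (Fin (n + 1)) (Fin (n + 1)) ℝ |
          ∀ x y, lorentz (M *ᵥ x) (M *ᵥ y) = lorentz x y} =
          ⋂ x, ⋂ y, {M | lorentz (M *ᵥ x) (M *ᵥ y) = lorentz x y} := by ext; simp
      change IsClosed {M : Matrix (Fin (n + 1)) (Fin (n + 1)) ℝ |
          ∀ x y, lorentz (M *ᵥ x) (M *ᵥ y) = lorentz x y}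
      rw [this]
      refine isClosed_iInter fun x => isClosed_iInter fun y => isClosed_eq ?_ continuous_const
      exact continuous_lorentz (continuous_id.matrix_mulVec continuous_const)
        (continuous_id.matrix_mulVec continuous_const)
    · exact isClosed_le continuous_const hc
    · exact isClosed_le hc continuous_const
  have hbox : IsCompact (Set.pi univ fun _ : Fin (n + 1) => Set.pi univ fun _ : Fin (n + 1) =>
      Icc (-Real.sqrt (1 + R ^ 2)) (Real.sqrt (1 + R ^ 2))) :=
    isCompact_univ_pi fun _ => isCompact_univ_pi fun _ => isCompact_Icc
  rw [himg]
  refine hbox.of_isClosed_subset hclosed ?_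
  rw [← himg]
  rintro _ ⟨A, hA, rfl⟩ i _ j _
  exact abs_le.1 (Real.abs_le_sqrt (entry_sq_le A hA i j))

/-- A discrete subgroup meets a compact set in a finite set. -/
theorem finite_bounded (Γ : Subgroup (Isom n)) [DiscreteTopology Γ] (R : ℝ) :
    {γ : Isom n | γ ∈ Γ ∧ γ.1.1 0 0 ≤ R}.Finite := by
  have h := Subgroup.tendsto_coe_cofinite_of_discrete Γ
    (isDiscrete_iff_discreteTopology.2 inferInstance)
  have h2 := h (isCompact_bounded R).compl_mem_cocompact
  rw [mem_map, mem_cofinite] at h2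
  refine (h2.image Subtype.val).subset ?_
  rintro γ ⟨h1, h3⟩
  exact ⟨⟨γ, h1⟩, by simpa using h3, rfl⟩

theorem mul_zero_coord_le (A : Isom n) (x : HSpace n) :
    (x.1 0 - Real.sqrt (∑ i : Fin n, x.1 i.succ ^ 2)) * A.1.1 0 0 ≤ (A • x).1 0 := by
  have h2 := (A⁻¹ • basePoint n).future.lorentz_le x.1
  have h4 : lorentz x.1 (A⁻¹ • basePoint n).1 = -(A • x).1 0 := by
    rw [lorentz_comm, smul_coe, lorentz_isom_inv, lorentz_comm]
    exact lorentz_single_zero _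
  rwa [smul_basePoint, inv_zero_coord, h4, neg_neg] at h2

/-- Makes cosh d(Ax, y) control the corner entry of A, so that orbits of discrete groups are locally
finite. -/
theorem exists_zero_coord_le (x y : HSpace n) :
    ∃ c : ℝ, 0 < c ∧ ∀ A : Isom n, c * A.1.1 0 0 ≤ -lorentz (A • x).1 y.1 := by
  have hx := future_iff.1 x.future
  have hy := future_iff.1 y.future
  refine ⟨(y.1 0 - Real.sqrt (∑ i : Fin n, y.1 i.succ ^ 2)) *
    (x.1 0 - Real.sqrt (∑ i : Fin n, x.1 i.succ ^ 2)),
    mul_pos (sub_pos.2 hy) (sub_pos.2 hx), fun A => ?_⟩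
  have h1 := (A • x).future.lorentz_le y.1
  rw [lorentz_comm (A • x).1]
  have := mul_le_mul_of_nonneg_left (mul_zero_coord_le A x) (sub_pos.2 hy).le
  linarith

theorem finite_orbit (Γ : Subgroup (Isom n)) [DiscreteTopology Γ] (x y : HSpace n) (R : ℝ) :
    {γ : Isom n | γ ∈ Γ ∧ -lorentz (γ • x).1 y.1 ≤ R}.Finite := by
  obtain ⟨c, hc, h⟩ := exists_zero_coord_le x y
  refine (finite_bounded Γ (R / c)).subset ?_
  rintro γ ⟨h1, h2⟩
  refine ⟨h1, ?_⟩
  rw [le_div_iff₀ hc]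
  linarith [h γ]

instance : T2Space (HSpace n) :=
  inferInstanceAs (T2Space {x : Fin (n + 1) → ℝ // lorentz x x = -1 ∧ 0 < x 0})

/-- A discrete group that acts freely acts properly discontinuously. -/
theorem IsManifoldGroup.exists_nhds {Γ : Subgroup (Isom n)} (hΓ : IsManifoldGroup Γ)
    (x : HSpace n) : ∃ U ∈ 𝓝 x, ∀ γ ∈ Γ, ∀ y ∈ U, γ • y ∈ U → γ = 1 := by
  have := hΓ.discrete
  have hx := future_iff.1 x.future
  obtain ⟨c, hc, hcx⟩ := exists_between (sub_pos.2 hx)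
  have hfin := finite_bounded Γ ((x.1 0 + 1) / c)
  have hcoord : ∀ i, Continuous fun y : HSpace n => y.1 i :=
    fun i => (continuous_apply i).comp continuous_subtype_val
  have h1 : ∀ᶠ y : HSpace n in 𝓝 x, c < y.1 0 - Real.sqrt (∑ i : Fin n, y.1 i.succ ^ 2) :=
    (isOpen_lt continuous_const ((hcoord 0).sub (Real.continuous_sqrt.comp
      (continuous_finsetSum _ fun i _ => (hcoord i.succ).pow 2)))).mem_nhds hcx
  have h2 : ∀ᶠ y : HSpace n in 𝓝 x, y.1 0 < x.1 0 + 1 :=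
    (isOpen_lt (hcoord 0) continuous_const).mem_nhds (by simp)
  -- Only these finitely many elements can carry a point near x to a point near x, and each of them
  -- except 1 moves x.
  have h3 : ∀ᶠ p : HSpace n × HSpace n in 𝓝 (x, x),
      ∀ γ ∈ {γ : Isom n | γ ∈ Γ ∧ γ.1.1 0 0 ≤ (x.1 0 + 1) / c}, γ ≠ 1 → γ • p.1 ≠ p.2 := by
    rw [hfin.eventually_all]
    intro γ hγ
    by_cases hγ1 : γ = 1
    · simp [hγ1]
    · have hne : γ • x ≠ x := fun h => hγ1 (hΓ.free γ hγ.1 x h)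
      filter_upwards [(isOpen_ne_fun (f := fun p : HSpace n × HSpace n => γ • p.1)
        (g := fun p => p.2) (continuous_fst.const_smul γ) continuous_snd).mem_nhds hne]
        with p hp _ using hp
  have h4 : ∀ᶠ p : HSpace n × HSpace n in 𝓝 (x, x), ∀ γ ∈ Γ, γ • p.1 = p.2 → γ = 1 := by
    rw [nhds_prod_eq] at h3 ⊢
    filter_upwards [h3, h1.prod_inl (𝓝 x), h2.prod_inr (𝓝 x)] with p hp hp1 hp2 γ hγ hγp
    by_contra hne
    refine hp γ ⟨hγ, ?_⟩ hne hγp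
    rw [le_div_iff₀ hc]
    have h5 := mul_zero_coord_le γ p.1
    rw [hγp] at h5
    have h6 := one_le_zero_coord γ
    nlinarith
  rw [nhds_prod_eq] at h4
  obtain ⟨U, hU, h⟩ := eventually_prod_self_iff'.1 h4
  exact ⟨U, hU, fun γ hγ y hy hy' => h y hy _ hy' γ hγ rfl⟩

end Discrete

/-! ### Facets and symmetries of a polytope -/

theorem eq_smul_of_orthogonal {n : ℕ} {u v : Fin (n + 1) → ℝ} (hv : lorentz v v = 1)
    (h : ∀ w, lorentz w v = 0 → lorentz w u = 0) : u = lorentz u v • v := by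
  refine sub_eq_zero.1 (eq_zero_of_lorentz_eq_zero fun y => ?_)
  have hy := h (y - lorentz y v • v) (by rw [lorentz_sub_left, lorentz_smul_left, hv]; ring)
  rw [lorentz_sub_left, lorentz_smul_left] at hy
  rw [lorentz_sub_left, lorentz_smul_left, lorentz_comm u y, lorentz_comm v y,
    lorentz_comm u v]
  linarith

theorem reflection_mulVec {n : ℕ} (v : Fin (n + 1) → ℝ) (hv : lorentz v v = 1)
    (x : Fin (n + 1) → ℝ) :
    (reflection v hv).1.1 *ᵥ x = x + (-2 * lorentz x v) • v :=
  LinearMap.toMatrix'_mulVec (reflectionLin v) x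

namespace Polytope

variable {n : ℕ} (P : Polytope n)

/-- The points of the polytope that lie on none of its facets. -/
def IsInner (x : HSpace n) : Prop := ∀ k, lorentz x.1 (P.normal k) < 0

variable {P}

theorem IsInner.mem {x : HSpace n} (h : P.IsInner x) : x ∈ P.carrier := fun k => (h k).le

variable (P)

theorem isOpen_isInner : IsOpen {x | P.IsInner x} := by
  have : {x | P.IsInner x} = ⋂ k, {x : HSpace n | lorentz x.1 (P.normal k) < 0} := by
    ext; simp [IsInner]
  rw [this]
  exact isOpen_iInter_of_finite fun k =>
    isOpen_lt (continuous_lorentz continuous_subtype_val continuous_const) continuous_const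

/-- The segment from an interior point to an irredundancy witness crosses the `k`-th hyperplane; the
weights are those that cancel the product with the `k`-th normal. -/
theorem exists_facet_point (k : Fin P.numFacets) :
    ∃ p : HSpace n, lorentz p.1 (P.normal k) = 0 ∧
      ∀ l, l ≠ k → lorentz p.1 (P.normal l) < 0 := by
  obtain ⟨y, hy, hyl⟩ := P.irredundant k
  obtain ⟨o, ho⟩ := P.interior_nonempty
  have hf : Future ((-lorentz o.1 (P.normal k)) • y.1 + lorentz y.1 (P.normal k) • o.1) :=
    (y.future.smul (by linarith [ho k])).add (o.future.smul hy)
  refine ⟨normalize _, (lorentz_normalize_eq_zero hf _).2 ?_,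
    fun l hl => (lorentz_normalize_neg hf _).2 ?_⟩
  · rw [lorentz_add_left, lorentz_smul_left, lorentz_smul_left]
    ring
  · rw [lorentz_add_left, lorentz_smul_left, lorentz_smul_left]
    have h1 := mul_neg_of_pos_of_neg hy (ho l)
    have h2 := mul_nonneg_of_nonpos_of_nonpos (ho k).le (hyl l hl)
    linarith

theorem eventually_others_neg {k : Fin P.numFacets} {p : HSpace n}
    (hp : ∀ l, l ≠ k → lorentz p.1 (P.normal l) < 0) (w : Fin (n + 1) → ℝ) :
    ∀ᶠ ε : ℝ in 𝓝[>] 0, ∀ l, l ≠ k → lorentz (p.1 + ε • w) (P.normal l) < 0 := by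
  rw [eventually_all]
  intro l
  by_cases h : l = k
  · simp [h]
  · filter_upwards [eventually_lorentz_neg (hp l h) w] with ε hε _ using hε

variable {P}

theorem smul_mem_carrier_iff {s : Isom n} (hs : s ∈ P.symmetryGroup) (x : HSpace n) :
    s • x ∈ P.carrier ↔ x ∈ P.carrier := by
  have h : s • P.carrier = P.carrier := hs
  conv_lhs => rw [← h]
  exact smul_mem_smul_set_iff

/-- Near a point of facet `k` on no other facet, P is a half-space. The symmetry sends this point to
some facet `l`, so the half-space of `k` lies in the pull-back of that of `l`, which forces the unit
normals to correspond. -/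
theorem exists_symmetry_normal {s : Isom n} (hs : s ∈ P.symmetryGroup) (k : Fin P.numFacets) :
    ∃ l, s.1.1 *ᵥ P.normal k = P.normal l := by
  obtain ⟨p, hpk, hp⟩ := P.exists_facet_point k
  have hpm : p ∈ P.carrier := fun l => by
    by_cases h : l = k
    · rw [h, hpk]
    · exact (hp l h).le
  have hq : s • p ∈ P.carrier := (smul_mem_carrier_iff hs p).2 hpm
  -- Were the image of p inner, p could be pushed outward along its normal without leaving P.
  obtain ⟨l, hl⟩ : ∃ l, lorentz (s • p).1 (P.normal l) = 0 := by
    by_contra hne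
    push Not at hne
    have hin : P.IsInner (s • p) := fun l => lt_of_le_of_ne (hq l) (hne l)
    have h1 := ((tendsto_normalize p (P.normal k)).const_smul s).eventually
      (P.isOpen_isInner.mem_nhds hin)
    obtain ⟨ε, ⟨h1, hf⟩, h0⟩ := (h1.and (eventually_future p (P.normal k))).and
      self_mem_nhdsWithin |>.exists
    have h2 := (smul_mem_carrier_iff hs _).1 (IsInner.mem h1) k
    rw [lorentz_normalize_nonpos hf, lorentz_add_left, lorentz_smul_left, hpk,
      P.normal_unit] at h2
    have h0' : (0 : ℝ) < ε := h0
    linarith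
  refine ⟨l, ?_⟩
  have key : ∀ w, lorentz w (P.normal k) ≤ 0 →
      lorentz w ((s⁻¹).1.1 *ᵥ P.normal l) ≤ 0 := by
    intro w hw
    obtain ⟨ε, ⟨h1, hf⟩, h0⟩ := ((P.eventually_others_neg hp w).and
      (eventually_future p w)).and self_mem_nhdsWithin |>.exists
    have h0' : (0 : ℝ) < ε := h0
    have hm : normalize (p.1 + ε • w) ∈ P.carrier := fun j => by
      rw [lorentz_normalize_nonpos hf]
      by_cases h : j = k
      · rw [h, lorentz_add_left, hpk, lorentz_smul_left]
        nlinarith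
      · exact (h1 j h).le
    have h2 := (smul_mem_carrier_iff hs _).2 hm l
    rw [smul_coe, ← inv_inv s, lorentz_isom_inv, lorentz_normalize_nonpos hf, lorentz_add_left,
      lorentz_smul_left, ← lorentz_isom_inv, inv_inv, ← smul_coe, hl, zero_add] at h2
    exact nonpos_of_mul_nonpos_right h2 h0'
  have hu : (s⁻¹).1.1 *ᵥ P.normal l =
      lorentz ((s⁻¹).1.1 *ᵥ P.normal l) (P.normal k) • P.normal k := by
    refine eq_smul_of_orthogonal (P.normal_unit k) fun w hw => le_antisymm (key w hw.le) ?_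
    have h := key (-w) (by rw [lorentz_neg_left, hw, neg_zero])
    rw [lorentz_neg_left] at h
    linarith
  have hunit : lorentz ((s⁻¹).1.1 *ᵥ P.normal l) ((s⁻¹).1.1 *ᵥ P.normal l) = 1 := by
    rw [(s⁻¹).2.1, P.normal_unit]
  -- The factor `a` satisfies a² = 1; testing the inward direction excludes a = -1.
  have hneg := key (-P.normal k) (by rw [lorentz_neg_left, P.normal_unit]; norm_num)
  rw [lorentz_neg_left, lorentz_comm] at hneg
  set a := lorentz ((s⁻¹).1.1 *ᵥ P.normal l) (P.normal k)
  rw [hu, lorentz_smul_left, lorentz_smul_right, P.normal_unit] at hunit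
  have ha : a = 1 := by nlinarith
  rw [ha, one_smul] at hu
  rw [← hu]
  exact isom_inv_mulVec s⁻¹ (P.normal l)

theorem IsInner.smul {s : Isom n} (hs : s ∈ P.symmetryGroup) {x : HSpace n} (hx : P.IsInner x) :
    P.IsInner (s • x) := by
  intro k
  obtain ⟨l, hl⟩ := exists_symmetry_normal (inv_mem hs) k
  rw [smul_coe, lorentz_comm, ← lorentz_isom_inv, hl, lorentz_comm]
  exact hx l

/-- Even at a boundary point, moving towards an interior point reaches an open set of inner points
arbitrarily near. -/
theorem isom_eq_of_eventually_carrier {A B : Isom n} {p : HSpace n} (hp : p ∈ P.carrier)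
    (h : ∀ᶠ x in 𝓝 p, x ∈ P.carrier → A • x = B • x) : A = B := by
  obtain ⟨o, ho⟩ := P.interior_nonempty
  obtain ⟨ε, ⟨h1, hf⟩, h0⟩ := (((tendsto_normalize p o.1).eventually
    (eventually_eventually_nhds.2 h)).and (eventually_future p o.1)).and
    self_mem_nhdsWithin |>.exists
  have hin : P.IsInner (normalize (p.1 + ε • o.1)) := fun k => by
    rw [lorentz_normalize_neg hf, lorentz_add_left, lorentz_smul_left]
    have h0' : (0 : ℝ) < ε := h0
    nlinarith [hp k, ho k]
  refine isom_eq_of_eventually (p := normalize (p.1 + ε • o.1)) ?_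
  filter_upwards [h1, P.isOpen_isInner.mem_nhds hin] with x hx hxi using hx (IsInner.mem hxi)

/-- An isometry that fixes a facet pointwise is trivial or the reflection in this facet. -/
theorem eq_one_or_eq_reflection {A : Isom n} {k : Fin P.numFacets}
    (h : ∀ x ∈ P.facet k, A • x = x) :
    A = 1 ∨ A = reflection (P.normal k) (P.normal_unit k) := by
  obtain ⟨p, hpk, hp⟩ := P.exists_facet_point k
  set v := P.normal k with hv
  have hvv : lorentz v v = 1 := P.normal_unit k
  have hfix : ∀ z, Future z → lorentz z v = 0 →
      (∀ l, l ≠ k → lorentz z (P.normal l) < 0) → A.1.1 *ᵥ z = z := by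
    intro z hz hzk hzl
    have hm : normalize z ∈ P.facet k := by
      refine ⟨fun l => ?_, (lorentz_normalize_eq_zero hz _).2 hzk⟩
      rw [lorentz_normalize_nonpos hz]
      by_cases hl : l = k
      · rw [hl, ← hv, hzk]
      · exact (hzl l hl).le
    have h1 : A • normalize z = (1 : Isom n) • normalize z := by rw [h _ hm, one_smul]
    rw [smul_normalize_eq_iff _ _ hz] at h1
    simpa using h1
  -- The facet contains a neighbourhood of p in its hyperplane, so A fixes the whole linear
  -- hyperplane.
  have hperp : ∀ w, lorentz w v = 0 → A.1.1 *ᵥ w = w := by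
    intro w hw
    obtain ⟨ε, ⟨h1, hf⟩, h0⟩ := ((P.eventually_others_neg hp w).and
      (eventually_future p w)).and self_mem_nhdsWithin |>.exists
    have h2 := hfix _ hf (by rw [lorentz_add_left, lorentz_smul_left, hpk, hw]; simp) h1
    rw [Matrix.mulVec_add, hfix _ p.future hpk hp, Matrix.mulVec_smul] at h2
    exact smul_right_injective _ (ne_of_gt h0) (add_left_cancel h2)
  have hu : A.1.1 *ᵥ v = lorentz (A.1.1 *ᵥ v) v • v := by
    refine eq_smul_of_orthogonal hvv fun w hw => ?_
    have := A.2.1 w v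
    rwa [hperp w hw, hw] at this
  have hunit := A.2.1 v v
  set a := lorentz (A.1.1 *ᵥ v) v
  rw [hu, lorentz_smul_left, lorentz_smul_right, hvv] at hunit
  have hA : ∀ x, A.1.1 *ᵥ x = x + ((a - 1) * lorentz x v) • v := by
    intro x
    have h1 := hperp (x - lorentz x v • v)
      (by rw [lorentz_sub_left, lorentz_smul_left, hvv]; ring)
    rw [Matrix.mulVec_sub, Matrix.mulVec_smul, hu, sub_eq_iff_eq_add] at h1
    rw [h1]
    module
  have ha : (a - 1) * (a + 1) = 0 := by linarith
  rcases mul_eq_zero.1 ha with ha | ha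
  · left
    refine isom_ext fun w => ?_
    rw [hA, ha]
    simp
  · right
    refine isom_ext fun w => ?_
    rw [hA, reflection_mulVec, show a - 1 = -2 by linarith]

/-! ### Connectedness of the polytope and its facets, via convex cones -/

section Connected

variable (P)

/-- The cone over the polytope in Minkowski space. -/
def cone : Set (Fin (n + 1) → ℝ) := {z | Future z ∧ ∀ k, lorentz z (P.normal k) ≤ 0}

theorem convex_cone : Convex ℝ P.cone := by
  rw [convex_iff_forall_pos]
  intro x hx y hy a b ha hb _
  refine ⟨(hx.1.smul ha).add (hy.1.smul hb), fun k => ?_⟩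
  rw [lorentz_add_left, lorentz_smul_left, lorentz_smul_left]
  nlinarith [hx.2 k, hy.2 k]

theorem convex_cone_facet (k : Fin P.numFacets) :
    Convex ℝ {z | z ∈ P.cone ∧ lorentz z (P.normal k) = 0} := by
  rw [convex_iff_forall_pos]
  intro x hx y hy a b ha hb hab
  refine ⟨convex_iff_forall_pos.1 P.convex_cone hx.1 hy.1 ha hb hab, ?_⟩
  rw [lorentz_add_left, lorentz_smul_left, lorentz_smul_left, hx.2, hy.2]
  ring

theorem isPreconnected_carrier : IsPreconnected P.carrier := by
  have : P.carrier = normalize '' P.cone := by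
    ext x
    constructor
    · exact fun hx => ⟨x.1, ⟨x.future, hx⟩, normalize_self x⟩
    · rintro ⟨z, hz, rfl⟩ k
      exact (lorentz_normalize_nonpos hz.1 _).2 (hz.2 k)
  rw [this]
  exact P.convex_cone.isPreconnected.image _
    fun z hz => (continuousAt_normalize hz.1).continuousWithinAt

theorem isPreconnected_facet (k : Fin P.numFacets) : IsPreconnected (P.facet k) := by
  have : P.facet k = normalize '' {z | z ∈ P.cone ∧ lorentz z (P.normal k) = 0} := by
    ext x
    constructor
    · exact fun hx => ⟨x.1, ⟨⟨x.future, hx.1⟩, hx.2⟩, normalize_self x⟩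
    · rintro ⟨z, hz, rfl⟩
      exact ⟨fun l => (lorentz_normalize_nonpos hz.1.1 _).2 (hz.1.2 l),
        (lorentz_normalize_eq_zero hz.1.1 _).2 hz.2⟩
  rw [this]
  exact (P.convex_cone_facet k).isPreconnected.image _
    fun z hz => (continuousAt_normalize hz.1.1).continuousWithinAt

end Connected

/-! ### Finite volume makes the normals span -/

section Volume

variable (P)

/-- A direction orthogonal to all the normals leads out of the light cone inside the
polytope. -/
theorem exists_lightlike {u : Fin (n + 1) → ℝ} {o : HSpace n} (ho : P.IsInner o)
    (hu : ∀ k, lorentz u (P.normal k) = 0) (hu0 : u ≠ 0) (hou : ∀ t : ℝ, o.1 + t • u ≠ 0) :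
    ∃ ω : Fin n → ℝ, ∑ i, ω i ^ 2 = 1 ∧
      ∀ k, lorentz (Fin.cons 1 ω : Fin (n + 1) → ℝ) (P.normal k) < 0 := by
  have hcont : Continuous fun t : ℝ =>
      Real.sqrt (∑ i : Fin n, (o.1 + t • u) i.succ ^ 2) - (o.1 + t • u) 0 := by
    simp only [Pi.add_apply, Pi.smul_apply, smul_eq_mul]
    fun_prop
  -- The line cannot stay in the future cone: either its time coordinate vanishes somewhere or, if
  -- that is constant, some spatial coordinate grows to match it. The intermediate value theorem
  -- then puts a point on the light cone.
  obtain ⟨t₁, ht₁⟩ : ∃ t : ℝ,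
      0 ≤ Real.sqrt (∑ i : Fin n, (o.1 + t • u) i.succ ^ 2) - (o.1 + t • u) 0 := by
    by_cases h0 : u 0 = 0
    · obtain ⟨i, hi⟩ : ∃ i : Fin n, u i.succ ≠ 0 := by
        by_contra hne
        push Not at hne
        refine hu0 (funext fun j => ?_)
        induction j using Fin.cases with
        | zero => exact h0
        | succ i => exact hne i
      refine ⟨(o.1 0 - o.1 i.succ) / u i.succ, sub_nonneg.2 (Real.le_sqrt_of_sq_le ?_)⟩
      refine le_trans (le_of_eq ?_) (Finset.single_le_sum (f := fun j : Fin n =>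
        (o.1 + ((o.1 0 - o.1 i.succ) / u i.succ) • u) j.succ ^ 2) (fun i _ => sq_nonneg _)
        (Finset.mem_univ i))
      simp only [Pi.add_apply, Pi.smul_apply, smul_eq_mul, h0]
      rw [div_mul_cancel₀ _ hi]
      ring
    · refine ⟨-o.1 0 / u 0, sub_nonneg.2 (le_trans (le_of_eq ?_) (Real.sqrt_nonneg _))⟩
      simp only [Pi.add_apply, Pi.smul_apply, smul_eq_mul]
      rw [div_mul_cancel₀ _ h0]
      ring
  obtain ⟨t, ht⟩ := mem_range_of_exists_le_of_exists_ge hcont (c := 0)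
    ⟨0, by simpa using (future_iff.1 o.future).le⟩ ⟨t₁, ht₁⟩
  have hl : ∀ k, lorentz (o.1 + t • u) (P.normal k) < 0 := fun k => by
    rw [lorentz_add_left, lorentz_smul_left, hu, mul_zero, add_zero]; exact ho k
  have hne := hou t
  set z := o.1 + t • u
  have hsq : Real.sqrt (∑ i : Fin n, z i.succ ^ 2) = z 0 := sub_eq_zero.1 ht
  have hz0 : 0 < z 0 := by
    refine lt_of_le_of_ne (hsq ▸ Real.sqrt_nonneg _) fun h0 => hne (funext fun j => ?_)
    rw [← h0, Real.sqrt_eq_zero (Finset.sum_nonneg fun i _ => sq_nonneg _),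
      Finset.sum_eq_zero_iff_of_nonneg fun i _ => sq_nonneg _] at hsq
    induction j using Fin.cases with
    | zero => exact h0.symm
    | succ i => exact pow_eq_zero_iff two_ne_zero |>.1 (hsq i (Finset.mem_univ i))
  have hsum : ∑ i : Fin n, z i.succ ^ 2 = z 0 ^ 2 := by
    rw [← hsq, Real.sq_sqrt (Finset.sum_nonneg fun i _ => sq_nonneg _)]
  refine ⟨fun i => (z 0)⁻¹ * z i.succ, ?_, fun k => ?_⟩
  · simp only [mul_pow, ← Finset.mul_sum, hsum]
    field_simp
  · have : (Fin.cons 1 fun i => (z 0)⁻¹ * z i.succ : Fin (n + 1) → ℝ) = (z 0)⁻¹ • z := by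
      funext j
      induction j using Fin.cases with
      | zero => simp [hz0.ne']
      | succ i => simp
    rw [this, lorentz_smul_left]
    exact mul_neg_of_pos_of_neg (inv_pos.2 hz0) (hl k)

/-- A polytope whose closure at infinity contains an open set of ideal points has infinite
volume. -/
theorem not_lightlike (hn : n ≠ 0) (ω : Fin n → ℝ) (hω : ∑ i, ω i ^ 2 = 1)
    (h : ∀ k, lorentz (Fin.cons 1 ω : Fin (n + 1) → ℝ) (P.normal k) < 0) : False := by
  -- Dividing `lift y` by R gives time coordinate √(R⁻² + |y/R|²). The first component of q stands
  -- for R⁻¹, and q → (0, ω) is the approach to the ideal point.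
  have hev : ∀ᶠ q : ℝ × (Fin n → ℝ) in 𝓝 (0, ω),
      (∀ k, lorentz (Fin.cons (Real.sqrt (q.1 ^ 2 + ∑ i, q.2 i ^ 2)) q.2 : Fin (n + 1) → ℝ)
        (P.normal k) < 0) ∧ 1 / 2 < ∑ i, q.2 i ^ 2 ∧ ∑ i, q.2 i ^ 2 < 2 := by
    have hs : Continuous fun q : ℝ × (Fin n → ℝ) => ∑ i, q.2 i ^ 2 := by fun_prop
    refine Filter.Eventually.and ?_ (Filter.Eventually.and ?_ ?_)
    · rw [eventually_all]
      intro k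
      refine (isOpen_lt (continuous_lorentz (Continuous.finCons ?_ continuous_snd)
        continuous_const) continuous_const).mem_nhds ?_
      · fun_prop
      · simpa [hω] using h k
    · exact (isOpen_lt continuous_const hs).mem_nhds (by simp only [mem_ofPred_eq, hω]; norm_num)
    · exact (isOpen_lt hs continuous_const).mem_nhds (by simp only [mem_ofPred_eq, hω]; norm_num)
  obtain ⟨δ, hδ, hball⟩ := Metric.eventually_nhds_iff.1 hev
  obtain ⟨M, hM⟩ := exists_pow_lt_of_lt_one hδ (show (1 / 2 : ℝ) < 1 by norm_num)
  -- With R = 2^(m+M), these balls are R times a fixed ball about ω. There R²/2 < |y|² < 2R², so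
  -- doubling R makes them disjoint. M makes R⁻¹ < δ for every m.
  set B : ℕ → Set (Fin n → ℝ) := fun m =>
    Metric.ball ((2 : ℝ) ^ (m + M) • ω) (δ * 2 ^ (m + M)) with hB
  have hscale : ∀ m, ∀ y ∈ B m, ∃ y' : Fin n → ℝ, y = (2 : ℝ) ^ (m + M) • y' ∧
      (∀ k, lorentz (lift y).1 (P.normal k) < 0) ∧ 1 / 2 < ∑ i, y' i ^ 2 ∧
      ∑ i, y' i ^ 2 < 2 := by
    intro m y hy
    have hp : (0 : ℝ) < 2 ^ (m + M) := by positivity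
    refine ⟨((2 : ℝ) ^ (m + M))⁻¹ • y, by rw [smul_inv_smul₀ hp.ne'], ?_⟩
    have hd : dist (((1 / 2 : ℝ) ^ (m + M)), ((2 : ℝ) ^ (m + M))⁻¹ • y) ((0 : ℝ), ω) < δ := by
      rw [Prod.dist_eq, max_lt_iff]
      constructor
      · rw [Real.dist_eq, sub_zero, abs_of_pos (by positivity), pow_add]
        refine lt_of_le_of_lt (mul_le_of_le_one_left (by positivity) ?_) hM
        exact pow_le_one₀ (by norm_num) (by norm_num)
      · have h1 := Metric.mem_ball.1 hy
        have h2 : dist (((2 : ℝ) ^ (m + M))⁻¹ • y) (((2 : ℝ) ^ (m + M))⁻¹ •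
            ((2 : ℝ) ^ (m + M) • ω)) = ((2 : ℝ) ^ (m + M))⁻¹ * dist y ((2 : ℝ) ^ (m + M) • ω) := by
          rw [dist_smul₀, norm_inv, Real.norm_of_nonneg hp.le]
        rw [inv_smul_smul₀ hp.ne'] at h2
        rw [h2, inv_mul_lt_iff₀ hp]
        linarith
    obtain ⟨h1, h2, h3⟩ := hball hd
    refine ⟨fun k => ?_, h2, h3⟩
    have heq : (lift y).1 = (2 : ℝ) ^ (m + M) • (Fin.cons (Real.sqrt (((1 / 2 : ℝ) ^ (m + M)) ^ 2 +
        ∑ i, (((2 : ℝ) ^ (m + M))⁻¹ • y) i ^ 2)) (((2 : ℝ) ^ (m + M))⁻¹ • y) :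
          Fin (n + 1) → ℝ) := by
      funext j
      induction j using Fin.cases with
      | zero =>
        simp only [lift, Fin.cons_zero, Pi.smul_apply, smul_eq_mul]
        rw [← Real.sqrt_sq hp.le, ← Real.sqrt_mul (by positivity), Real.sqrt_sq hp.le]
        congr 1
        simp only [mul_pow, ← Finset.mul_sum]
        rw [mul_add, ← mul_assoc, ← mul_pow, ← mul_pow, ← mul_pow, mul_inv_cancel₀ hp.ne']
        norm_num
      | succ i => simp [lift, hp.ne']
    rw [heq, lorentz_smul_left]
    exact mul_neg_of_pos_of_neg hp (h1 k)
  have hdisj : Pairwise (Function.onFun Disjoint B) := by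
    have hlt : ∀ a b : ℕ, a < b → Disjoint (B a) (B b) := by
      intro a b hab
      rw [Set.disjoint_left]
      intro y hya hyb
      obtain ⟨y₁, h1, -, -, h2⟩ := hscale a y hya
      obtain ⟨y₂, h3, -, h4, -⟩ := hscale b y hyb
      have e1 : ∑ i, y i ^ 2 = ((2 : ℝ) ^ (a + M)) ^ 2 * ∑ i, y₁ i ^ 2 := by
        rw [h1]; simp [mul_pow, Finset.mul_sum]
      have e2 : ∑ i, y i ^ 2 = ((2 : ℝ) ^ (b + M)) ^ 2 * ∑ i, y₂ i ^ 2 := by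
        rw [h3]; simp [mul_pow, Finset.mul_sum]
      have hle : (2 : ℝ) * 2 ^ (a + M) ≤ 2 ^ (b + M) := by
        rw [← pow_succ']
        exact pow_le_pow_right₀ (by norm_num) (by omega)
      have hp : (0 : ℝ) < 2 ^ (a + M) := by positivity
      nlinarith [mul_pos hp hp]
    intro a b hab
    rcases lt_or_gt_of_ne hab with h' | h'
    · exact hlt a b h'
    · exact (hlt b a h').symm
  -- The sup-norm ball has Lebesgue volume (2δR)ⁿ and the density is at least 1/(2R) on it. As n ≥
  -- 1, the product is bounded below independently of m.
  have hterm : ∀ m, ENNReal.ofReal ((2 * δ) ^ n / 2) ≤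
      ∫⁻ y in B m, ENNReal.ofReal (1 / Real.sqrt (1 + ∑ i, y i ^ 2)) := by
    intro m
    have hp : (1 : ℝ) ≤ 2 ^ (m + M) := one_le_pow₀ (by norm_num)
    have hp0 : (0 : ℝ) < 2 ^ (m + M) := by positivity
    calc ENNReal.ofReal ((2 * δ) ^ n / 2)
        ≤ ENNReal.ofReal (1 / (2 * 2 ^ (m + M)) * (2 * (δ * 2 ^ (m + M))) ^ n) := by
          refine ENNReal.ofReal_le_ofReal ?_
          have h1 : (2 : ℝ) ^ (m + M) ≤ (2 ^ (m + M)) ^ n := le_self_pow₀ hp hn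
          have h2 : (2 * (δ * 2 ^ (m + M))) ^ n = (2 * δ) ^ n * (2 ^ (m + M)) ^ n := by
            rw [← mul_pow]; ring
          rw [h2, div_mul_eq_mul_div, one_mul, div_le_div_iff₀ (by norm_num) (by positivity)]
          have := mul_le_mul_of_nonneg_left h1 (show 0 ≤ (2 * δ) ^ n by positivity)
          linarith
      _ = ENNReal.ofReal (1 / (2 * 2 ^ (m + M))) * MeasureTheory.volume (B m) := by
          rw [hB, Real.volume_pi_ball _ (by positivity), Fintype.card_fin,
            ENNReal.ofReal_mul (by positivity)]
      _ = ∫⁻ _ in B m, ENNReal.ofReal (1 / (2 * 2 ^ (m + M))) := by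
          rw [MeasureTheory.setLIntegral_const]
      _ ≤ _ := by
          refine MeasureTheory.setLIntegral_mono' Metric.isOpen_ball.measurableSet fun y hy => ?_
          obtain ⟨y', h1, -, -, h3⟩ := hscale m y hy
          have e1 : ∑ i, y i ^ 2 = ((2 : ℝ) ^ (m + M)) ^ 2 * ∑ i, y' i ^ 2 := by
            rw [h1]; simp [mul_pow, Finset.mul_sum]
          refine ENNReal.ofReal_le_ofReal (one_div_le_one_div_of_le (by positivity) ?_)
          rw [Real.sqrt_le_left (by positivity), e1]
          nlinarith [mul_pos hp0 hp0]
  have htop : hvolume {x : HSpace n | ∀ k, lorentz x.1 (P.normal k) ≤ 0} = ∞ := by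
    refine top_le_iff.1 ?_
    calc (∞ : ℝ≥0∞) = ∑' _ : ℕ, ENNReal.ofReal ((2 * δ) ^ n / 2) :=
          (ENNReal.tsum_const_eq_top_of_ne_zero (ENNReal.ofReal_pos.2 (by positivity)).ne').symm
      _ ≤ ∑' m, ∫⁻ y in B m, ENNReal.ofReal (1 / Real.sqrt (1 + ∑ i, y i ^ 2)) :=
          ENNReal.tsum_le_tsum hterm
      _ = ∫⁻ y in ⋃ m, B m, ENNReal.ofReal (1 / Real.sqrt (1 + ∑ i, y i ^ 2)) :=
          (MeasureTheory.lintegral_iUnion (fun m => Metric.isOpen_ball.measurableSet) hdisj _).symm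
      _ ≤ _ := by
          refine MeasureTheory.lintegral_mono_set (iUnion_subset fun m y hy k => ?_)
          obtain ⟨-, -, h1, -⟩ := hscale m y hy
          exact (h1 k).le
  exact P.finite_volume.ne htop

/-- Moving an inner point along u changes no product with a normal, so the line leaves the light
cone at an ideal point strictly inside every half-space, contradicting finite volume. -/
theorem eq_zero_of_orthogonal (hn : n ≠ 0) {u : Fin (n + 1) → ℝ}
    (hu : ∀ k, lorentz u (P.normal k) = 0) : u = 0 := by
  by_contra hu0
  obtain ⟨o, ho⟩ := P.interior_nonempty
  obtain ⟨w, hw0, hw, how⟩ : ∃ w : Fin (n + 1) → ℝ, w ≠ 0 ∧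
      (∀ k, lorentz w (P.normal k) = 0) ∧ ∀ t : ℝ, o.1 + t • w ≠ 0 := by
    -- Without facets u could be parallel to o, and the line would pass through 0; a spatial basis
    -- vector replaces it.
    rcases isEmpty_or_nonempty (Fin P.numFacets) with he | ⟨⟨k⟩⟩
    · obtain ⟨m, rfl⟩ := Nat.exists_eq_succ_of_ne_zero hn
      refine ⟨Pi.single 1 1, by simp, fun k => (he.false k).elim, fun t ht => ?_⟩
      have := congrFun ht 0
      have h2 := o.2.2
      simp at this
      linarith
    · refine ⟨u, hu0, hu, fun t ht => ?_⟩
      have h1 := ho k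
      have h2 : lorentz (o.1 + t • u) (P.normal k) = 0 := by
        rw [ht]; simpa using lorentz_smul_left 0 (P.normal k) (P.normal k)
      rw [lorentz_add_left, lorentz_smul_left, hu] at h2
      linarith
  obtain ⟨ω, h1, h2⟩ := P.exists_lightlike ho hw hw0 how
  exact P.not_lightlike hn ω h1 h2

end Volume

theorem subsingleton_isom_zero : Subsingleton (Isom 0) := by
  have hone : ∀ A : Isom 0, A.1.1 0 0 = 1 := fun A => by
    have h := sum_sq_eq (A • basePoint 0).2.1
    have h2 := (A • basePoint 0).2.2
    rw [smul_basePoint] at h h2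
    simp at h
    nlinarith
  refine ⟨fun A B => Subtype.ext (Units.ext (Matrix.ext fun i j => ?_))⟩
  fin_cases i
  fin_cases j
  exact (hone A).trans (hone B).symm

variable (P)

/-- A polytope of finite volume has only finitely many symmetries. -/
theorem finite_symmetryGroup : (P.symmetryGroup : Set (Isom n)).Finite := by
  rcases eq_or_ne n 0 with rfl | hn
  · have := subsingleton_isom_zero
    exact Set.toFinite _
  · rw [← Set.finite_coe_iff]
    -- A symmetry is determined by how its inverse permutes the normals, since no nonzero vector is
    -- orthogonal to them all.
    choose σ hσ using fun s : P.symmetryGroup => exists_symmetry_normal (inv_mem s.2)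
    refine Finite.of_injective σ fun s t hst => Subtype.ext (isom_ext fun x => ?_)
    refine sub_eq_zero.1 (P.eq_zero_of_orthogonal hn fun k => ?_)
    rw [lorentz_sub_left, lorentz_comm, lorentz_comm _ (P.normal k), ← lorentz_isom_inv,
      ← lorentz_isom_inv, hσ, hσ, hst, sub_self]

end Polytope

/-! ### Local and global lifting through ℍⁿ → ℍⁿ / Γ -/

section Quotient

variable {n : ℕ} {Γ : Subgroup (Isom n)}

theorem QuotientSpace.mk_eq_iff {x y : HSpace n} :
    QuotientSpace.mk Γ x = QuotientSpace.mk Γ y ↔ ∃ γ ∈ Γ, γ • y = x := by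
  unfold QuotientSpace.mk
  rw [Quotient.eq, MulAction.orbitRel_apply, MulAction.mem_orbit_iff]
  exact ⟨fun ⟨γ, h⟩ => ⟨γ, γ.2, h⟩, fun ⟨γ, hγ, h⟩ => ⟨⟨γ, hγ⟩, h⟩⟩

theorem QuotientSpace.continuous_mk : Continuous (QuotientSpace.mk Γ) := continuous_quotient_mk'

/-- By proper discontinuity, the group element relating two lifts that both tend to p is eventually
constant. -/
theorem IsManifoldGroup.eventually_eq (hΓ : IsManifoldGroup Γ) {X : Type*} {F : Filter X}
    {a b : X → HSpace n} {γ : Isom n} (hγ : γ ∈ Γ) {p : HSpace n} (ha : Tendsto a F (𝓝 p))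
    (hb : Tendsto (fun x => γ • b x) F (𝓝 p))
    (h : ∀ᶠ x in F, QuotientSpace.mk Γ (a x) = QuotientSpace.mk Γ (b x)) :
    ∀ᶠ x in F, a x = γ • b x := by
  obtain ⟨U, hU, hUΓ⟩ := hΓ.exists_nhds p
  filter_upwards [h, ha hU, hb hU] with x hx hax hbx
  obtain ⟨γ', hγ', h'⟩ := QuotientSpace.mk_eq_iff.1 hx
  have h1 : (γ' * γ⁻¹) • γ • b x = a x := by rw [smul_smul, inv_mul_cancel_right, h']
  have h2 := hUΓ (γ' * γ⁻¹) (mul_mem hγ' (inv_mem hγ)) _ hbx (by rwa [h1])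
  rw [← h1, h2, one_smul]

/-- Two isometries that induce the same map to the quotient on a connected set differ there by a
single element of the group. -/
theorem IsManifoldGroup.exists_eqOn (hΓ : IsManifoldGroup Γ) {S : Set (HSpace n)}
    (hS : IsPreconnected S) (hne : S.Nonempty) {A B : Isom n}
    (h : ∀ x ∈ S, QuotientSpace.mk Γ (A • x) = QuotientSpace.mk Γ (B • x)) :
    ∃ γ ∈ Γ, ∀ x ∈ S, A • x = γ • B • x := by
  obtain ⟨x₀, hx₀⟩ := hne
  obtain ⟨γ, hγ, h₀⟩ := QuotientSpace.mk_eq_iff.1 (h x₀ hx₀)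
  have := isPreconnected_iff_preconnectedSpace.1 hS
  have hA : Continuous fun x : S => A • x.1 := continuous_subtype_val.const_smul A
  have hB : Continuous fun x : S => γ • B • x.1 := (continuous_subtype_val.const_smul B).const_smul γ
  have hclopen : IsClopen {x : S | A • x.1 = γ • B • x.1} := by
    refine ⟨isClosed_eq hA hB, isOpen_iff_mem_nhds.2 fun x hx => ?_⟩
    refine hΓ.eventually_eq hγ (p := A • x.1) (hA.tendsto x) ?_
      (Eventually.of_forall fun y : S => h y.1 y.2)
    have h2 := hB.tendsto x
    rwa [← show A • x.1 = γ • B • x.1 from hx] at h2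
  have huniv := hclopen.eq_univ ⟨⟨x₀, hx₀⟩, h₀.symm⟩
  exact ⟨γ, hγ, fun x hx => (huniv.symm ▸ mem_univ _ : (⟨x, hx⟩ : S) ∈ _)⟩

end Quotient

/-! ### The glued space, its charts and the tiles -/

namespace FacetPairing

variable {n : ℕ} {P : Polytope n} {G : FacetPairing P}

/-- A set of points in the disjoint union of the copies that is a union of gluing classes. -/
def IsSaturated (G : FacetPairing P) (S : Set (Fin G.numCopies × P.carrier)) : Prop :=
  ∀ a b, G.Rel a b → (a ∈ S ↔ b ∈ S)

/-- Lifting the membership predicate to the quotient avoids describing the generated equivalence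
relation. -/
theorem IsSaturated.mk_mem_iff {S : Set (Fin G.numCopies × P.carrier)} (hS : G.IsSaturated S)
    (a : Fin G.numCopies × P.carrier) : Quot.mk G.Rel a ∈ Quot.mk G.Rel '' S ↔ a ∈ S := by
  refine ⟨fun ⟨b, hb, hab⟩ => ?_, fun h => ⟨a, h, rfl⟩⟩
  have h := congrArg (Quot.lift (fun a => a ∈ S) fun a b hr => propext (hS a b hr)) hab
  exact h.mp hb

theorem map_smul_mem_facet (c : Fin G.numCopies × Fin P.numFacets) {x : HSpace n}
    (hx : x ∈ P.facet c.2) : G.map c • x ∈ P.facet (G.mate c).2 := by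
  rw [← G.map_facet c]
  exact smul_mem_smul_set hx

/-- An inner point lies on no facet, so its singleton is saturated. -/
theorem eq_of_point_eq {i j : Fin G.numCopies} {x y : P.carrier} (hx : P.IsInner x.1)
    (h : G.point i x = G.point j y) : i = j ∧ x = y := by
  have hS : G.IsSaturated {(i, x)} := by
    rintro a b ⟨k, hk, hm, hb⟩
    refine iff_of_false ?_ ?_
    · rintro rfl
      exact (hx k).ne hk.2
    · rintro rfl
      have := map_smul_mem_facet (G := G) (a.1, k) hk
      rw [← hb] at this
      exact (hx _).ne this.2
  have h2 := (hS.mk_mem_iff (j, y)).1 ⟨(i, x), rfl, h⟩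
  rw [mem_singleton_iff, Prod.mk.injEq] at h2
  exact ⟨h2.1.symm, h2.2.symm⟩

variable {Γ : Subgroup (Isom n)} {Φ : G.Space ≃ₜ QuotientSpace Γ}

/-- On each copy of the polytope, the homeomorphism is induced by one isometry. -/
theorem IsIsometric.exists_chart (hΦ : G.IsIsometric Φ) (hΓ : IsManifoldGroup Γ)
    (i : Fin G.numCopies) :
    ∃ g : Isom n, ∀ x : P.carrier, Φ (G.point i x) = QuotientSpace.mk Γ (g • x.1) := by
  obtain ⟨o, ho⟩ := P.interior_nonempty
  obtain ⟨g, hg⟩ := hΦ i ⟨o, Polytope.IsInner.mem ho⟩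
  have := isPreconnected_iff_preconnectedSpace.1 P.isPreconnected_carrier
  have hclopen : IsClopen {p : P.carrier |
      ∀ᶠ x in 𝓝 p, Φ (G.point i x) = QuotientSpace.mk Γ (g • x.1)} := by
    refine ⟨isClosed_of_closure_subset fun p hp => ?_, isOpen_iff_mem_nhds.2 fun p hp =>
      eventually_eventually_nhds.2 hp⟩
    obtain ⟨g', hg'⟩ := hΦ i p
    obtain ⟨q, hq, hq'⟩ :=
      ((mem_closure_iff_frequently.1 hp).and_eventually (eventually_eventually_nhds.2 hg')).exists
    have heq : ∀ᶠ x in 𝓝 q,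
        QuotientSpace.mk Γ (g' • x.1) = QuotientSpace.mk Γ (g • x.1) := by
      filter_upwards [hq, hq'] with x h1 h2 using h2.symm.trans h1
    obtain ⟨γ, hγ, h0⟩ := QuotientSpace.mk_eq_iff.1 heq.self_of_nhds
    have hc : ∀ A : Isom n, Tendsto (fun x : P.carrier => A • x.1) (𝓝 q) (𝓝 (A • q.1)) :=
      fun A => (continuous_subtype_val.const_smul A).tendsto q
    have hev := hΓ.eventually_eq hγ (hc g')
      (by have h := (hc g).const_smul γ; rwa [h0] at h) heq
    -- The two local isometries agree up to γ on P near q, hence everywhere; so g also represents Φ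
    -- near the limit point p.
    have hgg : g' = γ * g := by
      refine P.isom_eq_of_eventually_carrier q.2 ?_
      rw [nhds_subtype_eq_comap, eventually_comap] at hev
      filter_upwards [hev] with x hx hxP
      rw [hx ⟨x, hxP⟩ rfl, mul_smul]
    filter_upwards [hg'] with x hx
    rw [hx, hgg, mul_smul]
    exact QuotientSpace.mk_eq_iff.2 ⟨γ, hγ, rfl⟩
  have huniv := hclopen.eq_univ ⟨_, hg⟩
  refine ⟨g, fun x => ?_⟩
  have hx : x ∈ {p : P.carrier |
      ∀ᶠ x in 𝓝 p, Φ (G.point i x) = QuotientSpace.mk Γ (g • x.1)} := huniv ▸ mem_univ x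
  have hx' : ∀ᶠ y in 𝓝 x, Φ (G.point i y) = QuotientSpace.mk Γ (g • y.1) := hx
  exact hx'.self_of_nhds

/-- A choice of isometries that induce the homeomorphism on the copies of the polytope. -/
def IsAtlas (Φ : G.Space ≃ₜ QuotientSpace Γ) (g : Fin G.numCopies → Isom n) : Prop :=
  ∀ i, ∀ x : P.carrier, Φ (G.point i x) = QuotientSpace.mk Γ (g i • x.1)

variable {g : Fin G.numCopies → Isom n}

theorem IsAtlas.eq_of_mk_eq (hg : IsAtlas Φ g) {i j : Fin G.numCopies} {x y : HSpace n}
    (hx : P.IsInner x) (hy : y ∈ P.carrier)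
    (h : QuotientSpace.mk Γ (g i • x) = QuotientSpace.mk Γ (g j • y)) : i = j ∧ x = y := by
  have h1 : G.point i ⟨x, hx.mem⟩ = G.point j ⟨y, hy⟩ := by
    apply Φ.injective
    rw [hg, hg, h]
  have h2 := eq_of_point_eq hx h1
  exact ⟨h2.1, congrArg Subtype.val h2.2⟩

/-- The manifold has no boundary: no facet is glued to itself by the identity. -/
theorem IsAtlas.not_mirror (hg : IsAtlas Φ g) (hΓ : IsManifoldGroup Γ) {i : Fin G.numCopies}
    {k : Fin P.numFacets} (hmate : G.mate (i, k) = (i, k))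
    (hmap : ∀ x ∈ P.facet k, G.map (i, k) • x = x) : False := by
  obtain ⟨p, hpk, hp⟩ := P.exists_facet_point k
  have hpm : p ∈ P.carrier := fun l => by
    by_cases h : l = k
    · rw [h, hpk]
    · exact (hp l h).le
  obtain ⟨W, hW, hWΓ⟩ := hΓ.exists_nhds (g i • p)
  set U : Set (HSpace n) :=
    {x | (∀ l, l ≠ k → lorentz x.1 (P.normal l) < 0) ∧ g i • x ∈ interior W} with hU
  have hUo : IsOpen U := by
    refine IsOpen.inter (s := {x : HSpace n | ∀ l, l ≠ k → lorentz x.1 (P.normal l) < 0}) ?_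
      (isOpen_interior.preimage (continuous_const_smul (g i)))
    have : {x : HSpace n | ∀ l, l ≠ k → lorentz x.1 (P.normal l) < 0} =
        ⋂ l : {l // l ≠ k}, {x : HSpace n | lorentz x.1 (P.normal l) < 0} := by ext; simp
    rw [this]
    exact isOpen_iInter_of_finite fun l =>
      isOpen_lt (continuous_lorentz continuous_subtype_val continuous_const) continuous_const
  -- In U only facet `k` occurs, and it is glued to itself by the identity, so S is saturated and
  -- has open image in M. Yet this image is only a half-ball: a point pushed out of P along the
  -- normal is missed, since W allows no γ ≠ 1 to bring it back.
  set S : Set (Fin G.numCopies × P.carrier) := {a | a.1 = i ∧ a.2.1 ∈ U} with hS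
  have hfacet : ∀ {x : HSpace n} {l}, x ∈ U → x ∈ P.facet l → l = k := by
    intro x l hx hl
    by_contra h
    exact (hx.1 l h).ne hl.2
  have hsat : G.IsSaturated S := by
    rintro ⟨i₁, x⟩ ⟨i₂, y⟩ ⟨l, hl, hm, hy⟩
    dsimp only at hl hm hy
    have hmem : y.1 ∈ P.facet (G.mate (i₁, l)).2 := by
      rw [hy]; exact map_smul_mem_facet (G := G) (i₁, l) hl
    constructor
    · rintro ⟨rfl, hx⟩
      obtain rfl := hfacet hx hl
      rw [hmate] at hm
      rw [hmap _ hl] at hy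
      exact ⟨hm.symm, by dsimp only; rwa [hy]⟩
    · rintro ⟨rfl, hyU⟩
      have h2 := hfacet hyU hmem
      have h3 : (i₁, l) = (i₂, k) := by
        rw [← G.mate_mate (i₁, l), ← hmate]
        exact congrArg _ (Prod.ext hm h2)
      rw [Prod.mk.injEq] at h3
      obtain ⟨rfl, rfl⟩ := h3
      rw [hmap _ hl] at hy
      exact ⟨rfl, by dsimp only; rwa [← hy]⟩
  have hSo : IsOpen S := by
    refine IsOpen.inter (s := {a : Fin G.numCopies × P.carrier | a.1 = i})
      ((isOpen_discrete {i}).preimage continuous_fst) ?_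
    exact hUo.preimage (continuous_subtype_val.comp continuous_snd)
  have hQo : IsOpen (X := G.Space) (Quot.mk G.Rel '' S) := by
    refine isQuotientMap_quot_mk.isOpen_preimage.1 ?_
    have : Quot.mk G.Rel ⁻¹' (Quot.mk G.Rel '' S) = S := by
      ext a; exact hsat.mk_mem_iff a
    exact this.symm ▸ hSo
  have hVo : IsOpen (QuotientSpace.mk Γ ⁻¹' (Φ '' (Quot.mk G.Rel '' S))) :=
    (Φ.isOpenMap _ hQo).preimage QuotientSpace.continuous_mk
  have hpV : g i • p ∈ QuotientSpace.mk Γ ⁻¹' (Φ '' (Quot.mk G.Rel '' S)) :=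
    ⟨G.point i ⟨p, hpm⟩, ⟨(i, ⟨p, hpm⟩), ⟨rfl, hp, mem_interior_iff_mem_nhds.2 hW⟩, rfl⟩, hg i _⟩
  obtain ⟨ε, ⟨⟨h1, h2⟩, hf⟩, h0⟩ := ((((tendsto_normalize p (P.normal k)).const_smul
    (g i)).eventually ((hVo.mem_nhds hpV))).and (((tendsto_normalize p (P.normal k)).const_smul
    (g i)).eventually hW)).and (eventually_future p (P.normal k)) |>.and
    self_mem_nhdsWithin |>.exists
  obtain ⟨_, ⟨⟨j, x⟩, ⟨hj, hxU⟩, rfl⟩, hx⟩ := h1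
  dsimp only at hj hxU
  subst hj
  have hx' : QuotientSpace.mk Γ (g j • normalize (p.1 + ε • P.normal k)) =
      QuotientSpace.mk Γ (g j • x.1) := hx.symm.trans (hg j x)
  obtain ⟨γ, hγ, hγx⟩ := QuotientSpace.mk_eq_iff.1 hx'
  have hγ1 := hWΓ γ hγ (g j • x.1) (interior_subset hxU.2) (by rw [hγx]; exact h2)
  rw [hγ1, one_smul, smul_left_cancel_iff] at hγx
  have h3 := x.2 k
  rw [hγx, lorentz_normalize_nonpos hf, lorentz_add_left, lorentz_smul_left, hpk,
    P.normal_unit] at h3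
  have h0' : (0 : ℝ) < ε := h0
  linarith

/-- The isometries `h` for which `h P` is a tile of the tiling of hyperbolic space by the lifts of
the copies of `P`. -/
def IsTile (Γ : Subgroup (Isom n)) (g : Fin G.numCopies → Isom n) (h : Isom n) : Prop :=
  ∃ γ ∈ Γ, ∃ i, ∃ s ∈ P.symmetryGroup, h = γ * g i * s

/-- Injectivity of Φ at inner points identifies the copies and the points in them; freeness then
identifies the elements of Γ, leaving only a symmetry. -/
theorem IsAtlas.tile_eq (hg : IsAtlas Φ g) (hΓ : IsManifoldGroup Γ) {h h' : Isom n}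
    (hh : IsTile (P := P) Γ g h) (hh' : IsTile (P := P) Γ g h') {x y : HSpace n}
    (hx : P.IsInner x) (hy : y ∈ P.carrier) (hxy : h • x = h' • y) :
    h⁻¹ * h' ∈ P.symmetryGroup := by
  obtain ⟨γ, hγ, i, s, hs, rfl⟩ := hh
  obtain ⟨γ', hγ', j, s', hs', rfl⟩ := hh'
  simp only [mul_smul] at hxy
  have h1 : QuotientSpace.mk Γ (g i • s • x) = QuotientSpace.mk Γ (g j • s' • y) :=
    QuotientSpace.mk_eq_iff.2 ⟨γ⁻¹ * γ', mul_mem (inv_mem hγ) hγ', by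
      rw [mul_smul, ← hxy, inv_smul_smul]⟩
  obtain ⟨rfl, h2⟩ := hg.eq_of_mk_eq (hx.smul hs) ((P.smul_mem_carrier_iff hs' y).2 hy) h1
  rw [← h2] at hxy
  have h3 : γ⁻¹ * γ' = 1 := hΓ.free _ (mul_mem (inv_mem hγ) hγ') (g i • s • x) (by
    rw [mul_smul, ← hxy, inv_smul_smul])
  rw [← inv_mul_eq_one.1 h3]
  have : (γ * g i * s)⁻¹ * (γ * g i * s') = s⁻¹ * s' := by group
  rw [this]
  exact mul_mem (inv_mem hs) hs'

end FacetPairing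

/-! ### Reflections and the covering by reflected copies -/

namespace Polytope

variable {n : ℕ} {P : Polytope n}

theorem symmetry_mul_reflection (s : Isom n) {k l : Fin P.numFacets}
    (h : s.1.1 *ᵥ P.normal k = P.normal l) :
    s * reflection (P.normal k) (P.normal_unit k) =
      reflection (P.normal l) (P.normal_unit l) * s := by
  refine isom_ext fun w => ?_
  change (s.1.1 * (reflection (P.normal k) (P.normal_unit k)).1.1) *ᵥ w =
    ((reflection (P.normal l) (P.normal_unit l)).1.1 * s.1.1) *ᵥ w
  rw [← Matrix.mulVec_mulVec, ← Matrix.mulVec_mulVec, reflection_mulVec, reflection_mulVec,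
    Matrix.mulVec_add, Matrix.mulVec_smul, h, ← h, s.2.1]

theorem reflection_mul_self (v : Fin (n + 1) → ℝ) (hv : lorentz v v = 1) :
    reflection v hv * reflection v hv = 1 := by
  refine isom_ext fun w => ?_
  change ((reflection v hv).1.1 * (reflection v hv).1.1) *ᵥ w = (1 : Matrix _ _ ℝ) *ᵥ w
  rw [← Matrix.mulVec_mulVec, reflection_mulVec, reflection_mulVec, lorentz_add_left,
    lorentz_smul_left, hv, Matrix.one_mulVec]
  module

variable (P)

/-- The translates of the polytope by a discrete reflection group cover hyperbolic space. -/
theorem exists_smul_mem_carrier [DiscreteTopology P.reflectionGroup] (x : HSpace n) :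
    ∃ w ∈ P.reflectionGroup, w • x ∈ P.carrier := by
  obtain ⟨o, ho⟩ := P.interior_nonempty
  -- The minimized quantity is cosh of the distance to o, over a set made finite by discreteness. If
  -- the nearest orbit point lay beyond a facet, reflecting in it would bring it nearer.
  obtain ⟨w, ⟨hw, hwR⟩, hmin⟩ := Set.exists_min_image _
    (fun w : Isom n => -lorentz (w • x).1 o.1)
    (finite_orbit P.reflectionGroup x o (-lorentz x.1 o.1))
    ⟨1, one_mem _, by rw [one_smul]⟩
  refine ⟨w, hw, fun k => ?_⟩
  by_contra hk
  push Not at hk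
  set r := reflection (P.normal k) (P.normal_unit k) with hr
  have hlt : -lorentz ((r * w) • x).1 o.1 < -lorentz (w • x).1 o.1 := by
    rw [mul_smul, hr, reflection_smul_coe, lorentz_add_left, lorentz_smul_left,
      lorentz_comm (P.normal k)]
    nlinarith [mul_pos_of_neg_of_neg (ho k) (neg_lt_zero.2 hk)]
  exact absurd (hmin (r * w) ⟨mul_mem (Subgroup.subset_closure ⟨k, rfl⟩) hw,
    hlt.le.trans hwR⟩) (not_le.2 hlt)

end Polytope

/-! ### Stability of the tiling under the extended group -/

namespace FacetPairing

variable {n : ℕ} {P : Polytope n} {G : FacetPairing P} {Γ : Subgroup (Isom n)}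
  {Φ : G.Space ≃ₜ QuotientSpace Γ} {g : Fin G.numCopies → Isom n}

/-- The tile adjacent to a given tile along a facet is its mirror image. -/
theorem IsAtlas.tile_mul_reflection (hg : IsAtlas Φ g) (hΓ : IsManifoldGroup Γ)
    (hG : G.InducedBySymmetries) {h : Isom n} (hh : IsTile (P := P) Γ g h)
    (k : Fin P.numFacets) :
    IsTile (P := P) Γ g (h * reflection (P.normal k) (P.normal_unit k)) := by
  obtain ⟨γ₀, hγ₀, i, s₀, hs₀, rfl⟩ := hh
  obtain ⟨l, hl⟩ := P.exists_symmetry_normal hs₀ k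
  -- Moving the reflection past s₀ reduces to crossing facet `l` of the chart `g i`.
  rw [mul_assoc, P.symmetry_mul_reflection s₀ hl]
  obtain ⟨s, hs, hsmap⟩ := hG (i, l)
  obtain ⟨p, hpl, hp⟩ := P.exists_facet_point l
  have hpm : p ∈ P.facet l := ⟨fun j => by
    by_cases h : j = l
    · rw [h, hpl]
    · exact (hp j h).le, hpl⟩
  obtain ⟨γ, hγ, hγx⟩ := hΓ.exists_eqOn (P.isPreconnected_facet l) ⟨p, hpm⟩
    (A := g (G.mate (i, l)).1 * s) (B := g i) (fun x hx => by
      have hy := map_smul_mem_facet (G := G) (i, l) hx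
      rw [hsmap x hx] at hy
      rw [mul_smul, ← hg i ⟨x, hx.1⟩, ← hg (G.mate (i, l)).1 ⟨s • x, hy.1⟩]
      exact congrArg Φ (Quot.sound (r := G.Rel) ⟨l, hx, rfl, (hsmap x hx).symm⟩).symm)
  rcases P.eq_one_or_eq_reflection (A := (γ * g i)⁻¹ * (g (G.mate (i, l)).1 * s)) (k := l)
    (fun x hx => by rw [mul_smul, hγx x hx, ← mul_smul γ, inv_smul_smul]) with h1 | h1
  -- The partner tile would lie on top of the original one, so it is the same copy with s = 1, and
  -- the facet is a mirror.
  · exfalso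
    rw [inv_mul_eq_one] at h1
    have hin : ∀ x, P.IsInner x → (G.mate (i, l)).1 = i ∧ s • x = x := by
      intro x hx
      refine hg.eq_of_mk_eq (hx.smul hs) hx.mem (QuotientSpace.mk_eq_iff.2 ⟨γ, hγ, ?_⟩)
      rw [← mul_smul, ← mul_smul, h1]
    obtain ⟨o, ho⟩ := P.interior_nonempty
    have hs1 : s = 1 := by
      refine isom_eq_of_eventually (p := o) ?_
      filter_upwards [P.isOpen_isInner.mem_nhds ho] with x hx
      rw [(hin x hx).2, one_smul]
    have hmap : ∀ x ∈ P.facet l, G.map (i, l) • x = x := fun x hx => by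
      rw [hsmap x hx, hs1, one_smul]
    refine hg.not_mirror hΓ (i := i) (k := l) (Prod.ext (hin o ho).1 ?_) hmap
    have h2 := map_smul_mem_facet (G := G) (i, l) hpm
    rw [hmap p hpm] at h2
    by_contra hne
    exact (hp _ hne).ne h2.2
  · refine ⟨γ₀ * γ⁻¹, mul_mem hγ₀ (inv_mem hγ), (G.mate (i, l)).1, s * s₀, mul_mem hs hs₀, ?_⟩
    rw [← h1]
    group

/-- The right multiplications preserving the set of tiles form a group `K`; the equivalence in its
definition gives closure under inverses. It contains the generating reflections and the symmetries.
-/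
theorem IsAtlas.tile_mul (hg : IsAtlas Φ g) (hΓ : IsManifoldGroup Γ)
    (hG : G.InducedBySymmetries) {h w : Isom n} (hh : IsTile (P := P) Γ g h)
    (hw : w ∈ P.extendedGroup) : IsTile (P := P) Γ g (h * w) := by
  let K : Subgroup (Isom n) :=
    { carrier := {w | ∀ h, IsTile (P := P) Γ g h ↔ IsTile (P := P) Γ g (h * w)}
      one_mem' := fun h => by rw [mul_one]
      mul_mem' := fun {a b} ha hb h => by rw [ha h, hb (h * a), mul_assoc]
      inv_mem' := fun {a} ha h => by rw [ha (h * a⁻¹), inv_mul_cancel_right] }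
  have hK : P.extendedGroup ≤ K := by
    refine sup_le ((Subgroup.closure_le K).2 ?_) fun s hs h => ?_
    · rintro _ ⟨k, rfl⟩ h
      refine ⟨fun hh => hg.tile_mul_reflection hΓ hG hh k, fun hh => ?_⟩
      have := hg.tile_mul_reflection hΓ hG hh k
      rwa [mul_assoc, Polytope.reflection_mul_self, mul_one] at this
    · constructor
      · rintro ⟨γ, hγ, i, t, ht, rfl⟩
        exact ⟨γ, hγ, i, t * s, mul_mem ht hs, by group⟩
      · rintro ⟨γ, hγ, i, t, ht, hts⟩
        exact ⟨γ, hγ, i, t * s⁻¹, mul_mem ht (inv_mem hs), by rw [← mul_assoc, ← hts]; group⟩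
  exact (hK hw h).1 hh

theorem isTile_chart (Γ : Subgroup (Isom n)) (g : Fin G.numCopies → Isom n)
    (i : Fin G.numCopies) : IsTile (P := P) Γ g (g i) :=
  ⟨1, one_mem _, i, 1, one_mem _, by group⟩

/-- Elements keeping an inner point o inner form an open neighbourhood of 1. They make tiles
overlap, so they lie in the finite group Sym(P); removing the others, a finite closed set, isolates
1. -/
theorem IsAtlas.discreteTopology_extendedGroup (hg : IsAtlas Φ g) (hΓ : IsManifoldGroup Γ)
    (hG : G.InducedBySymmetries) (i : Fin G.numCopies) : DiscreteTopology P.extendedGroup := by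
  obtain ⟨o, ho⟩ := P.interior_nonempty
  have hopen : IsOpen {w : P.extendedGroup | P.IsInner (w.1 • o)} :=
    P.isOpen_isInner.preimage ((continuous_smul_const o).comp continuous_subtype_val)
  have hfin : {w : P.extendedGroup | P.IsInner (w.1 • o)}.Finite := by
    refine (P.finite_symmetryGroup.preimage Subtype.val_injective.injOn).subset fun w hw => ?_
    have := hg.tile_eq hΓ (isTile_chart Γ g i) (hg.tile_mul hΓ hG (isTile_chart Γ g i) w.2)
      hw (Polytope.IsInner.mem ho) (mul_smul (g i) w.1 o).symm
    rwa [inv_mul_cancel_left] at this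
  refine discreteTopology_of_isOpen_singleton_one ?_
  have h1 := hopen.sdiff (hfin.subset (sdiff_subset (t := {1}))).isClosed
  have h2 : (1 : P.extendedGroup) ∈ {w : P.extendedGroup | P.IsInner (w.1 • o)} := by
    change P.IsInner ((1 : Isom n) • o)
    rwa [one_smul]
  rwa [sdiff_sdiff_cancel_left (singleton_subset_iff.2 h2)] at h1

end FacetPairing

/-! ### Finite index and the final assembly -/

theorem relIndex_ne_zero_of_finite {A : Type*} [Group A] {H K : Subgroup A} {T : Set A}
    (hT : T.Finite) (h : ∀ k ∈ K, ∃ a ∈ H, ∃ t ∈ T, k = a * t) : H.relIndex K ≠ 0 := by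
  have := hT.to_subtype
  -- The quotient consists of left cosets while K ⊆ HT uses right cosets, so representatives are
  -- inverted.
  choose a ha t ht hk using fun q : K ⧸ H.subgroupOf K => h _ (inv_mem q.out.2)
  have hfin : Finite (K ⧸ H.subgroupOf K) := by
    refine Finite.of_injective (fun q => (⟨t q, ht q⟩ : T)) fun q r hqr => ?_
    have hqr' : t q = t r := congrArg Subtype.val hqr
    rw [← q.out_eq', ← r.out_eq', QuotientGroup.eq, Subgroup.mem_subgroupOf]
    have : ((q.out⁻¹ * r.out : K) : A) = a q * (a r)⁻¹ := by
      rw [Subgroup.coe_mul, Subgroup.coe_inv, hk q, ← inv_inv (r.out : A), hk r, hqr']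
      group
    rw [this]
    exact mul_mem (ha q) (inv_mem (ha r))
  exact Subgroup.index_ne_zero_of_finite

theorem exists_isOrbifoldCovering {n : ℕ} {Γ Λ : Subgroup (Isom n)} {g : Isom n}
    (h : conj g Γ ≤ Λ) :
    ∃ f : QuotientSpace Γ → QuotientSpace Λ, IsOrbifoldCovering f := by
  refine ⟨Quotient.lift (fun x => QuotientSpace.mk Λ (g • x)) fun x y hxy => ?_,
    g, h, fun x => rfl⟩
  obtain ⟨γ, hγ, hx⟩ := QuotientSpace.mk_eq_iff.1 (Quotient.sound hxy : QuotientSpace.mk Γ x = _)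
  refine QuotientSpace.mk_eq_iff.2 ⟨g * γ * g⁻¹, h ⟨γ, hγ, rfl⟩, ?_⟩
  rw [mul_smul, mul_smul, inv_smul_smul, hx]

end Hyperbolic

theorem lemma3p2 {n : ℕ} (P : Hyperbolic.Polytope n) (hP : P.IsCoxeter)
    (G : Hyperbolic.FacetPairing P) (hG : G.InducedBySymmetries)
    (Γ : Subgroup (Hyperbolic.Isom n)) (hΓ : Hyperbolic.IsManifoldGroup Γ)
    (Φ : G.Space ≃ₜ Hyperbolic.QuotientSpace Γ) (hΦ : G.IsIsometric Φ) :
    DiscreteTopology P.reflectionGroup ∧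
    Hyperbolic.OrbifoldCommensurable Γ P.reflectionGroup ∧
    DiscreteTopology P.extendedGroup ∧
    ∃ f : Hyperbolic.QuotientSpace Γ → Hyperbolic.QuotientSpace P.extendedGroup,
      Hyperbolic.IsOrbifoldCovering f := by
  open Hyperbolic Hyperbolic.FacetPairing in
  obtain ⟨o, ho⟩ := P.interior_nonempty
  -- There is at least one copy of P, because ℍⁿ / Γ is nonempty.
  obtain ⟨⟨i, _⟩, _⟩ := Quot.exists_rep (Φ.symm (QuotientSpace.mk Γ o))
  choose g hg using hΦ.exists_chart hΓ
  have hg : IsAtlas Φ g := hg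
  have hext := hg.discreteTopology_extendedGroup hΓ hG i
  have hle : P.reflectionGroup ≤ P.extendedGroup := le_sup_left
  have hrefl : DiscreteTopology P.reflectionGroup :=
    DiscreteTopology.of_subset (s := (P.extendedGroup : Set (Isom n))) hext hle
  have htile : ∀ w ∈ P.extendedGroup, IsTile (P := P) Γ g (g i * w) :=
    fun w hw => hg.tile_mul hΓ hG (isTile_chart Γ g i) hw
  -- A reflected copy of `g i` P contains the inner point h o of the tile, so it is that tile.
  have hcover : ∀ h, IsTile (P := P) Γ g h →
      ∃ w ∈ P.reflectionGroup, ∃ s ∈ P.symmetryGroup, h = g i * w * s := by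
    intro h hh
    obtain ⟨w, hw, hx⟩ := P.exists_smul_mem_carrier ((g i)⁻¹ • h • o)
    have h1 := hg.tile_eq hΓ hh (htile w⁻¹ (hle (inv_mem hw))) ho hx
      (by rw [mul_smul, inv_smul_smul, smul_inv_smul])
    exact ⟨w⁻¹, inv_mem hw, _, inv_mem h1, by group⟩
  have hΓle : ∀ γ ∈ Γ, (g i)⁻¹ * γ * g i ∈ P.extendedGroup := by
    intro γ hγ
    obtain ⟨w, hw, s, hs, h⟩ := hcover (γ * g i) ⟨γ, hγ, i, 1, one_mem _, by group⟩
    rw [mul_assoc, h, mul_assoc, inv_mul_cancel_left]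
    exact mul_mem (hle hw) (Subgroup.mem_sup_right hs)
  refine ⟨hrefl, ⟨g i, ?_⟩, hext, exists_isOrbifoldCovering (g := (g i)⁻¹) ?_⟩
  -- The extended group is the intermediate term: up to conjugation it contains both groups with
  -- finite index.
  · have h1 : Γ.Commensurable (conj (g i) P.extendedGroup) := by
      constructor
      · refine relIndex_ne_zero_of_finite (T := Set.image2 (fun j s => g j * s * (g i)⁻¹) Set.univ
          (P.symmetryGroup : Set (Isom n))) (Set.finite_univ.image2 _ P.finite_symmetryGroup) ?_
        rintro _ ⟨w, hw, rfl⟩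
        obtain ⟨γ, hγ, j, s, hs, h⟩ := htile w hw
        refine ⟨γ, hγ, _, ⟨j, Set.mem_univ _, s, hs, rfl⟩, ?_⟩
        change g i * w * (g i)⁻¹ = _
        rw [h]
        group
      · refine relIndex_ne_zero_of_finite (Set.finite_singleton 1) fun γ hγ =>
          ⟨γ, ⟨_, hΓle γ hγ, ?_⟩, 1, rfl, (mul_one _).symm⟩
        change g i * _ * (g i)⁻¹ = _
        group
    have h2 : (conj (g i) P.extendedGroup).Commensurable (conj (g i) P.reflectionGroup) := by
      constructor
      · refine relIndex_ne_zero_of_finite (Set.finite_singleton 1) fun γ hγ =>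
          ⟨γ, Subgroup.map_mono hle hγ, 1, rfl, (mul_one _).symm⟩
      · refine relIndex_ne_zero_of_finite (T := (fun s => g i * s * (g i)⁻¹) ''
          (P.symmetryGroup : Set (Isom n))) (P.finite_symmetryGroup.image _) ?_
        rintro _ ⟨w, hw, rfl⟩
        obtain ⟨w', hw', s, hs, h⟩ := hcover (g i * w) (htile w hw)
        rw [mul_assoc, mul_right_inj] at h
        refine ⟨_, ⟨w', hw', rfl⟩, _, ⟨s, hs, rfl⟩, ?_⟩
        change g i * w * (g i)⁻¹ = (g i * w' * (g i)⁻¹) * _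
        rw [h]
        group
    exact h1.trans h2
  · rintro _ ⟨γ, hγ, rfl⟩
    change (g i)⁻¹ * γ * (g i)⁻¹⁻¹ ∈ _
    rw [inv_inv]
    exact hΓle γ hγ
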